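/- Let $d\ge 2$, let $\mathcal I_1,\dots,\mathcal I_d$ be finite sets, $\mathcal I=\mathcal I_1\times\dots\times\mathcal I_d$, and let $G$ be the chain with vertices $1,\dots,d$ and edges $\{j,j+1\}$, $1\le j\le d-1$. Let ${\bf p}=({\bf p}(i))_{i\in\mathcal I}$ be a vector of random cell probabilities, that is, a random vector with ${\bf p}(i)>0$ for all $i\in\mathcal I$ and $\sum_{i\in\mathcal I}{\bf p}(i)=1$ almost surely. Write $\mathbb P_{\bf p}(X=i)={\bf p}(i)$, where $X=(X_1,\dots,X_d)$, and suppose that, almost surely, ${\bf p}$ factorizes with respect to $G$: $${\bf p}(i)=\frac{\prod_{j=1}^{d-1}\mathbb P_{\bf p}(X_j=i_j,\,X_{j+1}=i_{j+1})}{\prod_{j=2}^{d-1}\mathbb P_{\bf p}(X_j=i_j)},\qquad i\in\mathcal I .$$ Use the convention $X_0=X_{d+1}=0$ and $\mathcal I_0=\mathcal I_{d+1}=\{0\}$. Assume that the random vectors $$\bigl(\mathbb P_{\bf p}(X_j=l\mid X_{j-1}=k),\ l\in\mathcal I_j\bigr),\qquad k\in\mathcal I_{j-1},\ j=1,\dots,d,$$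 are jointly independent and non-degenerate (none of these vectors is almost surely constant), and that the random vectors $$\bigl(\mathbb P_{\bf p}(X_j=l\mid X_{j+1}=m),\ l\in\mathcal I_j\bigr),\qquad m\in\mathcal I_{j+1},\ j=1,\dots,d,$$ are jointly independent and non-degenerate. Then ${\bf p}$ has a hyper Dirichlet distribution with respect to $G$. Here the hyper Dirichlet distribution with respect to a decomposable graph is the one given by its moments: for a perfect order $C_1,\dots,C_K$ of the cliques, with separators $S_1=\emptyset$ and $S_l=C_l\cap(C_1\cup\dots\cup C_{l-1})$, there are positive numbers $\alpha$, $\alpha^{C_l}_k$ ($k\in\mathcal I_{C_l}$) and $\alpha^{S_l}_n$ ($n\in\mathcal I_{S_l}$), with $\alpha^{S_1}=\alpha$, where $\mathcal I_A=\prod_{v\in A}\mathcal I_v$, such that $\alpha^{S}_n=\sum_{k\in\mathcal I_C:\,k_S=n}\alpha^C_k$ for every separator $S$ (including $\emptyset$), every clique $C\supseteq S$ and every $n\in\mathcal I_S$, and $$\mathbb E\prod_{i\in\mathcal I}{\bf p}(i)^{r_i}=\frac{\mathcal Z(\alpha+r)}{\mathcal Z(\alpha)},\qquad \mathcal Z(\alpha)=\frac{\prod_{l=1}^{K}\prod_{k\in\mathcal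 I_{C_l}}\Gamma(\alpha^{C_l}_k)}{\Gamma(\alpha)\prod_{l=2}^{K}\prod_{n\in\mathcal I_{S_l}}\Gamma(\alpha^{S_l}_n)},$$ for all tables $r=(r_i)_{i\in\mathcal I}$ of non-negative integers, where $\alpha+r$ means that the total $\sum_i r_i$ is added to $\alpha$ and the marginal count $r^A_k=\sum_{i:\,i_A=k}r_i$ is added to $\alpha^A_k$ for $A=C_l,S_l$. For the chain, the cliques are the edges $\{j,j+1\}$ and the separators, besides $\emptyset$, are the sets $\{j\}$, $2\le j\le d-1$. -/

import Mathlib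

open MeasureTheory ProbabilityTheory

noncomputable section

namespace HyperDirichlet

/-! ### Marginal and conditional tables

`V` is the set of variables, `I v` the finite set of values of variable `v`, and
`(v : V) → I v` the set of cells. A marginal cell of `A : Finset V` is an element
of `(a : A) → I a`. -/

section Tables

variable {V : Type*} [Fintype V] [DecidableEq V] {I : V → Type*} [∀ v, Fintype (I v)]
  [∀ v, DecidableEq (I v)]

/-- The `A`-marginal `x^A(k) = ∑_{i : i_A = k} x(i)` of a table `x`. -/
def marginal {M : Type*} [AddCommMonoid M] (x : ((v : V) → I v) → M) (A : Finset V)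
    (k : (a : A) → I a) : M :=
  ∑ i : (v : V) → I v with A.restrict i = k, x i

/-- The conditional probability `P_x(X_v = m | X_A = k)`, where `x i = P_x(X = i)`.
For `A = ∅` (and its unique marginal cell) this is `P_x(X_v = m)` when `x` has total mass `1`. -/
def condProb (x : ((v : V) → I v) → ℝ) (v : V) (A : Finset V) (k : (a : A) → I a)
    (m : I v) : ℝ :=
  (∑ i : (v : V) → I v with A.restrict i = k ∧ i v = m, x i) / marginal x A k

end Tables

/-! ### Cliques, perfect orders, factorization -/

section Graph

variable {V : Type*} [DecidableEq V]

/-- The `l`-th separator `S_l = C_l ∩ (C_1 ∪ ⋯ ∪ C_{l-1})` of a sequence of sets;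
the first separator is `∅`. -/
def separator {K : ℕ} (C : Fin K → Finset V) (l : Fin K) : Finset V :=
  C l ∩ (Finset.Iio l).biUnion C

/-- `C_1, …, C_K` is a perfect order of the cliques (inclusion-maximal complete sets) of `G`:
each clique is listed exactly once and every separator, after the first, is contained in an
earlier clique. -/
structure IsPerfectCliqueOrder (G : SimpleGraph V) {K : ℕ} (C : Fin K → Finset V) : Prop where
  injective : Function.Injective C
  mem_range : ∀ D : Finset V,
    (∃ l, C l = D) ↔ Maximal (fun A : Finset V => G.IsClique (A : Set V)) D
  running : ∀ l : Fin K, 0 < l.val → ∃ i : Fin K, i < l ∧ separator C l ⊆ C i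

variable [Fintype V] {I : V → Type*} [∀ v, Fintype (I v)] [∀ v, DecidableEq (I v)]

/-- The probability table `x` factorizes with respect to the decomposable graph `G`:
`x(i) = ∏_l x^{C_l}(i_{C_l}) / ∏_{l ≥ 2} x^{S_l}(i_{S_l})` for a perfect order of the cliques. -/
def Factorizes (G : SimpleGraph V) (x : ((v : V) → I v) → ℝ) : Prop :=
  ∃ (K : ℕ) (C : Fin K → Finset V), IsPerfectCliqueOrder G C ∧
    ∀ i : (v : V) → I v,
      x i = (∏ l : Fin K, marginal x (C l) ((C l).restrict i)) /
        ∏ l : Fin K with 0 < l.val, marginal x (separator C l) ((separator C l).restrict i)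

/-- The constant `Z(α) = ∏_l ∏_k Γ(α^{C_l}_k) / (Γ(α) ∏_{l ≥ 2} ∏_k Γ(α^{S_l}_k))`.
The factor `Γ(α)` is the one of the first separator `S_1 = ∅`, which has a single marginal cell. -/
def normConst {K : ℕ} (C : Fin K → Finset V) (α : (A : Finset V) → ((a : A) → I a) → ℝ) : ℝ :=
  (∏ l : Fin K, ∏ k : (a : C l) → I a, Real.Gamma (α (C l) k)) /
    ∏ l : Fin K, ∏ k : (a : separator C l) → I a, Real.Gamma (α (separator C l) k)

/-- The family `α` (only its members at cliques and separators matter) is a system of hyper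
Dirichlet parameters: positive numbers such that `α^S_n = ∑_{k ∈ I_C, k_S = n} α^C_k` whenever
the separator `S` (with `S_1 = ∅` included) is contained in the clique `C`. -/
structure IsHyperParameter {K : ℕ} (C : Fin K → Finset V)
    (α : (A : Finset V) → ((a : A) → I a) → ℝ) : Prop where
  clique_pos : ∀ l k, 0 < α (C l) k
  separator_pos : ∀ l n, 0 < α (separator C l) n
  consistent : ∀ (l m : Fin K) (h : separator C l ⊆ C m) (n : (a : separator C l) → I a),
    α (separator C l) n =
      ∑ k : (a : C m) → I a with Finset.restrict₂ (π := I) h k = n, α (C m) k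

variable {Ω : Type*} [MeasurableSpace Ω]

/-- `p` is a vector of random cell probabilities: a random vector of positive numbers with
sum `1`. -/
structure IsRandomProbability (μ : Measure Ω) (p : Ω → ((v : V) → I v) → ℝ) : Prop where
  measurable : ∀ i, Measurable fun ω => p ω i
  pos : ∀ᵐ ω ∂μ, ∀ i, 0 < p ω i
  sum_eq_one : ∀ᵐ ω ∂μ, ∑ i, p ω i = 1

/-- `p` has a hyper Dirichlet distribution with respect to the decomposable graph `G`. The
distribution is given by its moments,
`E ∏_i p(i)^{r_i} = Z(α + r) / Z(α)` for all tables `r` of non-negative integers,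
where `r` is added to `α` through its marginals `r^{C_l}`, `r^{S_l}`. -/
def HasHyperDirichletLaw (G : SimpleGraph V) (μ : Measure Ω)
    (p : Ω → ((v : V) → I v) → ℝ) : Prop :=
  ∃ (K : ℕ) (C : Fin K → Finset V), IsPerfectCliqueOrder G C ∧
    ∃ α : (A : Finset V) → ((a : A) → I a) → ℝ, IsHyperParameter C α ∧
      ∀ r : ((v : V) → I v) → ℕ,
        ∫ ω, ∏ i, p ω i ^ r i ∂μ =
          normConst C (fun A k => α A k + ((marginal r A k : ℕ) : ℝ)) / normConst C α

/-- Parameter independence of `p` with respect to the DAG with parent function `pa`: the random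
vectors `(P_p(X_v = m | X_{pa v} = k), m ∈ I v)`, for all `v` and all `k ∈ I_{pa v}`, are jointly
independent and non-degenerate (none is almost surely constant). -/
structure ParameterIndependence (μ : Measure Ω) (p : Ω → ((v : V) → I v) → ℝ)
    (pa : V → Finset V) : Prop where
  indep : iIndepFun (fun (s : Σ v : V, ((a : pa v) → I a)) (ω : Ω) (m : I s.1) =>
    condProb (p ω) s.1 (pa s.1) s.2 m) μ
  nondegenerate : ∀ (v : V) (k : (a : pa v) → I a),
    ¬ ∃ c : I v → ℝ, ∀ᵐ ω ∂μ, condProb (p ω) v (pa v) k = c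

end Graph

/-! ### The chain -/

/-- Parents in the DAG `1 → 2 → ⋯ → d`: the first vertex has none, `j` has parent `j - 1`. -/
def forwardParents (d : ℕ) (j : Fin d) : Finset (Fin d) :=
  Finset.univ.filter fun i => i.val + 1 = j.val

/-- Parents in the DAG `1 ← 2 ← ⋯ ← d`: the last vertex has none, `j` has parent `j + 1`. -/
def backwardParents (d : ℕ) (j : Fin d) : Finset (Fin d) :=
  Finset.univ.filter fun i => j.val + 1 = i.val

end HyperDirichlet

end

/-!
The ratios of successive moments of `p` form a prediction rule: the conditional probability, given a
table of counts, that the next observation falls into a given cell. Independence of the conditional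
probabilities in both directions along an edge makes the prediction of the two-way table of this
edge factor by rows and also by columns. Comparing the two factorizations, the factor by which an
observation changes the probabilities of the other cells depends on the sample size only. This
forces the prediction rule of a Pólya urn: probabilities proportional to `mean + c * count` with a
reinforcement `c ≥ 0`. Edges sharing a vertex have the same `c`, and `c = 0` would make the second
moments of all conditional probabilities squares of their means, hence `p` almost surely constant.
After dividing all weights by `c`, the product of the predictive conditional probabilities along
`1 → 2 → ⋯ → d` is a quotient of clique and separator marginals, which by `Γ (x + 1) = x * Γ x` is
also the ratio of successive normalizing constants.
-/

noncomputable section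

namespace HyperDirichlet

/-! ### Tables of counts -/

section Pushforward

variable {X Y M : Type*} [Finite X] [Finite Y] [AddCommMonoid M]

theorem map_add (f : X → Y) (r s : X → M) :
    FunOnFinite.map f (r + s) = FunOnFinite.map f r + FunOnFinite.map f s := by
  classical
  cases nonempty_fintype X
  ext y
  simp only [FunOnFinite.map_apply_apply, Pi.add_apply, Finset.sum_add_distrib]

theorem map_id (r : X → M) : FunOnFinite.map (fun x => x) r = r :=
  congrFun (FunOnFinite.map_id M) r

theorem map_map {Z : Type*} [Finite Z] (g : Y → Z) (f : X → Y) (r : X → M) :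
    FunOnFinite.map g (FunOnFinite.map f r) = FunOnFinite.map (fun x => g (f x)) r :=
  (congrFun (FunOnFinite.map_comp g f) r).symm

theorem map_apply_of_injective {f : X → Y} (hf : f.Injective) (r : X → M) (x : X) :
    FunOnFinite.map f r (f x) = r x := by
  classical
  cases nonempty_fintype X
  simp [FunOnFinite.map_apply_apply, hf.eq_iff, Finset.sum_filter]

theorem map_swap_apply {K L : Type*} [Finite K] [Finite L] (r : K × L → M) (x : L × K) :
    FunOnFinite.map Prod.swap r x = r x.swap :=
  map_apply_of_injective Prod.swap_injective r x.swap

theorem map_const [Fintype X] [DecidableEq Y] (y : Y) (r : X → M) :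
    FunOnFinite.map (fun _ => y) r = Pi.single y (∑ x, r x) := by
  ext z
  rcases eq_or_ne z y with rfl | hz
  · simp [FunOnFinite.map_apply_apply]
  · simp [FunOnFinite.map_apply_apply, hz, hz.symm]

theorem sum_map [Fintype X] [Fintype Y] (f : X → Y) (r : X → M) :
    ∑ y, FunOnFinite.map f r y = ∑ x, r x := by
  classical
  simpa only [FunOnFinite.map_apply_apply] using
    Finset.sum_fiberwise_of_maps_to (fun x _ => Finset.mem_univ (f x)) r

theorem map_fst_apply {K L : Type*} [Finite K] [Fintype L] (r : K × L → M) (k : K) :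
    FunOnFinite.map Prod.fst r k = ∑ l, r (k, l) := by
  classical
  cases nonempty_fintype K
  rw [FunOnFinite.map_apply_apply, Finset.sum_filter, Fintype.sum_prod_type_right]
  simp

theorem map_addMonoidHom_comp {N : Type*} [AddCommMonoid N] (φ : M →+ N) (f : X → Y) (r : X → M)
    (y : Y) : FunOnFinite.map f (fun x => φ (r x)) y = φ (FunOnFinite.map f r y) := by
  classical
  cases nonempty_fintype X
  simp only [FunOnFinite.map_apply_apply, map_sum]

theorem map_pos {f : X → Y} (hf : f.Surjective) {x : X → ℝ} (hx : ∀ i, 0 < x i) (y : Y) :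
    0 < FunOnFinite.map f x y := by
  classical
  cases nonempty_fintype X
  obtain ⟨i, rfl⟩ := hf y
  rw [FunOnFinite.map_apply_apply]
  exact Finset.sum_pos (fun i _ => hx i) ⟨i, by simp⟩

theorem prod_pow_map {N : Type*} [CommMonoid N] [Fintype X] [Fintype Y] (f : X → Y) (g : Y → N)
    (r : X → ℕ) : ∏ y, g y ^ FunOnFinite.map f r y = ∏ x, g (f x) ^ r x := by
  classical
  simp only [FunOnFinite.map_apply_apply, ← Finset.prod_pow_eq_pow_sum]
  rw [← Finset.prod_fiberwise Finset.univ f]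
  refine Finset.prod_congr rfl fun y _ => Finset.prod_congr rfl fun x hx => ?_
  rw [(Finset.mem_filter.1 hx).2]

end Pushforward

theorem table_induction {ι : Type*} [Finite ι] [DecidableEq ι] {P : (ι → ℕ) → Prop}
    (zero : P 0) (add_single : ∀ r i, P r → P (r + Pi.single i 1)) (r : ι → ℕ) : P r := by
  have hcount (s : Multiset ι) : P fun i => s.count i := by
    induction s using Multiset.induction_on with
    | empty => simp only [Multiset.count_zero]; exact zero
    | cons i s ih =>
      convert add_single _ i ih using 2 with j
      simp [Multiset.count_cons, Pi.single_apply]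
  cases nonempty_fintype ι
  simpa [Multiset.count_sum', Multiset.count_singleton] using hcount (∑ i, r i • {i})

theorem sum_add_single {ι : Type*} [Fintype ι] [DecidableEq ι] (r : ι → ℕ) (i : ι) :
    ∑ j, (r + Pi.single i 1 : ι → ℕ) j = ∑ j, r j + 1 := by
  simp [Finset.sum_add_distrib]

/-! ### Prediction rules -/

section PredictionRule

variable {ι : Type*} [Fintype ι]

/-- `P r i` is the probability that the next observation falls into cell `i`, given that the
previous ones have the table of counts `r`; all these probabilities are positive. -/
structure IsPredictionRule (P : (ι → ℕ) → ι → ℝ) : Prop where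
  pos : ∀ r i, 0 < P r i
  sum_eq_one : ∀ r, ∑ i, P r i = 1

/-- `P` is the prediction rule of a Pólya urn with initial weights `b` and reinforcement `c`, that
is `P r i = (b i + c * r i) / ∑ j, (b j + c * r j)`, cleared of its denominator. -/
def IsPolya (P : (ι → ℕ) → ι → ℝ) (b : ι → ℝ) (c : ℝ) : Prop :=
  ∀ r i, P r i * (∑ j, b j + c * ∑ j, (r j : ℝ)) = b i + c * r i

theorem IsPolya.const_mul {P : (ι → ℕ) → ι → ℝ} {b : ι → ℝ} {c : ℝ} (h : IsPolya P b c) (d : ℝ) :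
    IsPolya P (fun i => d * b i) (d * c) := fun r i => by
  rw [← Finset.mul_sum, mul_assoc d c, ← mul_add, mul_left_comm, h r i]
  ring

theorem IsPolya.reinforcement_unique [Nontrivial ι] {P : (ι → ℕ) → ι → ℝ} {b : ι → ℝ} {c c' : ℝ}
    (hP : IsPredictionRule P) (h : IsPolya P b c) (h' : IsPolya P b c') : c = c' := by
  classical
  obtain ⟨i, j, hij⟩ := exists_pair_ne ι
  have hlt : P (Pi.single i 1) i < 1 :=
    hP.sum_eq_one (Pi.single i 1) ▸ Finset.single_lt_sum hij.symm (Finset.mem_univ i)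
      (Finset.mem_univ j) (hP.pos _ j) fun _ _ _ => (hP.pos _ _).le
  have h₁ := h (Pi.single i 1) i
  have h₁' := h' (Pi.single i 1) i
  simp only [← Nat.cast_sum, Finset.sum_pi_single', Finset.mem_univ, if_true, Pi.single_eq_same,
    Nat.cast_one, mul_one] at h₁ h₁'
  have : (c - c') * (1 - P (Pi.single i 1) i) = 0 := by linarith
  rcases mul_eq_zero.1 this with h | h <;> linarith

variable [DecidableEq ι]

theorem eq_add_mul_of_sum_eq [Nontrivial ι] {T : (ι → ℕ) → ι → ℝ} {H : ℕ → ℝ}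
    (hT : ∀ r i j, i ≠ j → T (r + Pi.single j 1) i = T r i)
    (hsum : ∀ r, ∑ i, T r i = H (∑ j, r j)) (r : ι → ℕ) (i : ι) :
    T r i = T 0 i + (H 1 - H 0) * r i := by
  have increment (r : ι → ℕ) (i : ι) :
      T (r + Pi.single i 1) i - T r i = H (∑ j, r j + 1) - H (∑ j, r j) := by
    rw [← sum_add_single r i, ← hsum, ← hsum, ← Finset.sum_sub_distrib,
      Fintype.sum_eq_single i fun j hj => by rw [hT r j i hj, sub_self]]
  obtain ⟨a, b, hab⟩ := exists_pair_ne ι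
  -- An observation in the cell `b` changes the total but not the increment at `a`.
  have increment_succ (n : ℕ) : H (n + 2) - H (n + 1) = H (n + 1) - H n := by
    have h₁ := increment (Pi.single a n) a
    have h₂ := increment (Pi.single a n + Pi.single b 1) a
    rw [add_right_comm, hT _ a b hab, hT _ a b hab, sum_add_single, h₁] at h₂
    simpa using h₂.symm
  have increment_eq (n : ℕ) : H (n + 1) - H n = H 1 - H 0 := by
    induction n with
    | zero => rfl
    | succ n ih => rw [increment_succ, ih]
  induction r using table_induction with
  | zero => simp
  | add_single r j ih =>
    rcases eq_or_ne i j with rfl | hij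
    · have := increment r i
      rw [increment_eq] at this
      simp only [Pi.add_apply, Pi.single_eq_same, Nat.cast_add, Nat.cast_one]
      linarith
    · simp [hT r i j hij, ih, hij]

theorem nonneg_of_forall_one_add_mul_pos {c : ℝ} (h : ∀ n : ℕ, 0 < 1 + c * n) : 0 ≤ c := by
  by_contra! hc
  obtain ⟨n, hn⟩ := exists_nat_gt (-c)⁻¹
  have : 1 < -c * n := by rwa [inv_lt_iff_one_lt_mul₀' (neg_pos.2 hc)] at hn
  linarith [h n]

/-- If an observation in one cell changes the predictive probabilities of the other cells by a
factor depending on the sample size only, then these probabilities become additive after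
multiplication by the product of the inverse factors. -/
theorem IsPredictionRule.exists_isPolya [Nontrivial ι] {P : (ι → ℕ) → ι → ℝ}
    (hP : IsPredictionRule P) {U : ℕ → ℝ}
    (hU : ∀ r i j, i ≠ j → P (r + Pi.single j 1) i = U (∑ k, r k) * P r i) :
    ∃ c, 0 ≤ c ∧ IsPolya P (P 0) c := by
  obtain ⟨a, b, hab⟩ := exists_pair_ne ι
  have U_pos (n : ℕ) : 0 < U n := by
    have h := hP.pos (Pi.single a n + Pi.single b 1) a
    rw [hU _ a b hab, Finset.sum_pi_single', if_pos (Finset.mem_univ a)] at h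
    exact pos_of_mul_pos_left h (hP.pos _ _).le
  let H (n : ℕ) : ℝ := ∏ m ∈ Finset.range n, (U m)⁻¹
  have H_pos (n : ℕ) : 0 < H n := Finset.prod_pos fun m _ => inv_pos.2 (U_pos m)
  have sum_mul_H (r : ι → ℕ) : ∑ i, P r i * H (∑ j, r j) = H (∑ j, r j) := by
    rw [← Finset.sum_mul, hP.sum_eq_one, one_mul]
  have mul_H (r : ι → ℕ) (i : ι) : P r i * H (∑ j, r j) = P 0 i + (H 1 - 1) * r i := by
    have := eq_add_mul_of_sum_eq (T := fun r i => P r i * H (∑ j, r j)) (H := H) ?_ sum_mul_H r i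
    · simpa [H] using this
    · intro r i j hij
      simp only [H, sum_add_single, Finset.prod_range_succ, hU r i j hij]
      field_simp [(U_pos _).ne']
  have H_eq (r : ι → ℕ) : H (∑ j, r j) = 1 + (H 1 - 1) * ∑ j, (r j : ℝ) := by
    rw [← sum_mul_H, Finset.sum_congr rfl fun i _ => mul_H r i, Finset.sum_add_distrib,
      hP.sum_eq_one, Finset.mul_sum]
  refine ⟨H 1 - 1, nonneg_of_forall_one_add_mul_pos fun n => ?_, fun r i => ?_⟩
  · have := H_pos (∑ j, (Pi.single a n : ι → ℕ) j)
    rw [H_eq, ← Nat.cast_sum] at this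
    simpa only [Finset.sum_pi_single', Finset.mem_univ, if_true] using this
  · rw [hP.sum_eq_one, ← H_eq, mul_H]

end PredictionRule

/-! ### Two-way tables -/

section TwoWay

variable {K L : Type*} [Fintype K] [Fintype L]

/-- An observation of a two-way table is predicted by predicting its row from the row totals, and
then its column from the counts in that row. -/
def FactorsByRow (P : (K × L → ℕ) → K × L → ℝ) (A : (K → ℕ) → K → ℝ)
    (B : K → (L → ℕ) → L → ℝ) : Prop :=
  ∀ r k l, P r (k, l) = A (FunOnFinite.map Prod.fst r) k * B k (fun l => r (k, l)) l

/-- The prediction rule of the transposed two-way table. -/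
def transposeRule (P : (K × L → ℕ) → K × L → ℝ) (r : L × K → ℕ) (x : L × K) : ℝ :=
  P (FunOnFinite.map Prod.swap r) x.swap

variable {P : (K × L → ℕ) → K × L → ℝ} {b : K × L → ℝ} {c : ℝ}

theorem IsPredictionRule.transpose (hP : IsPredictionRule P) :
    IsPredictionRule (transposeRule P) where
  pos _ _ := hP.pos _ _
  sum_eq_one r := by
    rw [← hP.sum_eq_one (FunOnFinite.map Prod.swap r)]
    exact (Equiv.prodComm L K).sum_comp _

theorem IsPolya.transpose (h : IsPolya P b c) :
    IsPolya (transposeRule P) (fun x => b x.swap) c := by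
  intro r x
  have := h (FunOnFinite.map Prod.swap r) x.swap
  rw [map_swap_apply, Prod.swap_swap] at this
  simp only [transposeRule, ← this, ← Nat.cast_sum, sum_map]
  rw [← (Equiv.prodComm L K).sum_comp b]
  rfl

variable {A : (K → ℕ) → K → ℝ} {B : K → (L → ℕ) → L → ℝ}

theorem FactorsByRow.isPolya_row_totals [Nonempty L] (hPAB : FactorsByRow P A B)
    (hB : ∀ k, IsPredictionRule (B k)) (h : IsPolya P b c) :
    IsPolya A (fun k => ∑ l, b (k, l)) c := by
  classical
  intro r k
  let l₀ : L := Classical.arbitrary L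
  let s : K × L → ℕ := FunOnFinite.map (fun k => (k, l₀)) r
  have map_fst : FunOnFinite.map Prod.fst s = r := by
    simp only [s, map_map, map_id]
  have sum_row : ∑ l, s (k, l) = r k := by rw [← map_fst_apply, map_fst]
  have sum_P : ∑ l, P s (k, l) = A r k := by
    simp only [hPAB s k, map_fst, ← Finset.mul_sum, (hB k).sum_eq_one, mul_one]
  have total : ∑ x, (s x : ℝ) = ∑ k, (r k : ℝ) := by simp only [s, ← Nat.cast_sum, sum_map]
  rw [← sum_P, ← Fintype.sum_prod_type' (f := fun k l => b (k, l)), ← total, Finset.sum_mul,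
    Finset.sum_congr rfl fun l _ => h s (k, l), Finset.sum_add_distrib, ← Finset.mul_sum, ← sum_row,
    Nat.cast_sum]

theorem FactorsByRow.isPolya_row (hPAB : FactorsByRow P A B) (hB : ∀ k, IsPredictionRule (B k))
    (h : IsPolya P b c) (k : K) : IsPolya (B k) (fun l => b (k, l)) c := by
  intro r l
  let s : K × L → ℕ := FunOnFinite.map (fun l => (k, l)) r
  have row_eq (l : L) : s (k, l) = r l := map_apply_of_injective (Prod.mk_right_injective k) r l
  have total : ∑ x, (s x : ℝ) = ∑ l, (r l : ℝ) := by simp only [s, ← Nat.cast_sum, sum_map]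
  have P_eq (l : L) : P s (k, l) = A (FunOnFinite.map Prod.fst s) k * B k r l := by
    simp only [hPAB s k l, row_eq]
  have h_row (l : L) := h s (k, l)
  simp only [P_eq, total, row_eq] at h_row
  have h_sum := Finset.sum_congr rfl fun l (_ : l ∈ Finset.univ) => h_row l
  rw [← Finset.sum_mul, ← Finset.mul_sum, (hB k).sum_eq_one, mul_one, Finset.sum_add_distrib,
    ← Finset.mul_sum] at h_sum
  rw [← h_sum, ← h_row l]
  ring

theorem FactorsByRow.apply_add_single [DecidableEq K] [DecidableEq L] (hPAB : FactorsByRow P A B)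
    (hP : IsPredictionRule P) (r : K × L → ℕ) {i j : K × L} (hij : i.1 ≠ j.1) :
    P (r + Pi.single j 1) i = A (FunOnFinite.map Prod.fst r + Pi.single j.1 1) i.1 /
      A (FunOnFinite.map Prod.fst r) i.1 * P r i := by
  obtain ⟨k, l⟩ := i
  have hA : A (FunOnFinite.map Prod.fst r) k ≠ 0 :=
    left_ne_zero_of_mul (hPAB r k l ▸ (hP.pos r (k, l)).ne')
  have row_eq : (fun l => (r + Pi.single j 1 : K × L → ℕ) (k, l)) = fun l => r (k, l) := by
    ext l
    simp [Prod.ext_iff, hij]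
  rw [hPAB, hPAB r, row_eq, map_add, FunOnFinite.map_piSingle]
  field_simp

theorem FactorsByRow.apply_add_single_of_transposeRule [DecidableEq K] [DecidableEq L]
    {A : (L → ℕ) → L → ℝ} {B : L → (K → ℕ) → K → ℝ} (hPAB : FactorsByRow (transposeRule P) A B)
    (hP : IsPredictionRule P) (r : K × L → ℕ) {i j : K × L} (hij : i.2 ≠ j.2) :
    P (r + Pi.single j 1) i = A (FunOnFinite.map Prod.snd r + Pi.single j.2 1) i.2 /
      A (FunOnFinite.map Prod.snd r) i.2 * P r i := by
  have := hPAB.apply_add_single hP.transpose (FunOnFinite.map Prod.swap r)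
    (i := i.swap) (j := j.swap) hij
  simp only [transposeRule, map_add, map_map, FunOnFinite.map_piSingle, Prod.swap_swap,
    map_id] at this
  exact this

/-- A table can be replaced by one with the same row totals which is concentrated in a single
column, and likewise for the column totals. -/
theorem exists_eq_sum_of_map_fst_eq_map_snd [Nontrivial K] [Nontrivial L] {M : Type*}
    {R : (K → ℕ) → K → K → M} {S : (L → ℕ) → L → L → M}
    (h : ∀ (r : K × L → ℕ) {k k' : K} {l l' : L}, k ≠ k' → l ≠ l' →
      R (FunOnFinite.map Prod.fst r) k k' = S (FunOnFinite.map Prod.snd r) l l') :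
    ∃ U : ℕ → M, (∀ ρ k k', k ≠ k' → R ρ k k' = U (∑ x, ρ x)) ∧
      ∀ σ l l', l ≠ l' → S σ l l' = U (∑ x, σ x) := by
  classical
  obtain ⟨k₁, k₀, hk⟩ := exists_pair_ne K
  obtain ⟨l₁, l₀, hl⟩ := exists_pair_ne L
  have R_eq (ρ : K → ℕ) (k k' : K) (hkk' : k ≠ k') :
      R ρ k k' = S (Pi.single l₀ (∑ x, ρ x)) l₁ l₀ := by
    have := h (FunOnFinite.map (fun k => (k, l₀)) ρ) hkk' hl
    rwa [map_map, map_map, map_const, map_id] at this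
  refine ⟨fun n => S (Pi.single l₀ n) l₁ l₀, R_eq, fun σ l l' hll' => ?_⟩
  have := h (FunOnFinite.map (fun l => (k₀, l)) σ) hk hll'
  rw [map_map, map_map, map_const, R_eq _ _ _ hk, map_id] at this
  simpa using this.symm

/-- The factor by which an observation changes the predictive probability of a cell in another row
and another column depends on the table only through its row totals, and only through its column
totals, hence on the sample size only. -/
theorem exists_isPolya_of_factorsByRow [Nontrivial K] [Nontrivial L] (hP : IsPredictionRule P)
    {A' : (L → ℕ) → L → ℝ} {B' : L → (K → ℕ) → K → ℝ} (hrow : FactorsByRow P A B)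
    (hcol : FactorsByRow (transposeRule P) A' B') :
    ∃ c, 0 ≤ c ∧ IsPolya P (P 0) c := by
  classical
  have ratio_eq (r : K × L → ℕ) {k k' : K} {l l' : L} (hk : k ≠ k') (hl : l ≠ l') :
      A (FunOnFinite.map Prod.fst r + Pi.single k' 1) k / A (FunOnFinite.map Prod.fst r) k =
        A' (FunOnFinite.map Prod.snd r + Pi.single l' 1) l / A' (FunOnFinite.map Prod.snd r) l :=
    mul_right_cancel₀ (hP.pos r (k, l)).ne' <|
      (hrow.apply_add_single hP r (i := (k, l)) (j := (k', l')) hk).symm.trans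
        (hcol.apply_add_single_of_transposeRule hP r hl)
  obtain ⟨U, row_ratio, col_ratio⟩ := exists_eq_sum_of_map_fst_eq_map_snd
    (R := fun ρ k k' => A (ρ + Pi.single k' 1) k / A ρ k)
    (S := fun σ l l' => A' (σ + Pi.single l' 1) l / A' σ l) ratio_eq
  refine hP.exists_isPolya (U := U) fun r i j hij => ?_
  by_cases h : i.1 = j.1
  · have hl : i.2 ≠ j.2 := fun h' => hij (Prod.ext h h')
    rw [hcol.apply_add_single_of_transposeRule hP r hl, col_ratio _ _ _ hl, sum_map]
  · rw [hrow.apply_add_single hP r h, row_ratio _ _ _ h, sum_map]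

end TwoWay

/-! ### Moments of random probability vectors -/

section Moments

variable {ι : Type*} [Fintype ι] {Ω : Type*} [MeasurableSpace Ω]

/-- The moment `E ∏ i, q i ^ r i` of a random vector `q`. -/
def mixedMoment (μ : Measure Ω) (q : Ω → ι → ℝ) (r : ι → ℕ) : ℝ :=
  ∫ ω, ∏ i, q ω i ^ r i ∂μ

/-- The vector of the means of a random vector. -/
def mean (μ : Measure Ω) (q : Ω → ι → ℝ) (i : ι) : ℝ :=
  ∫ ω, q ω i ∂μ

/-- The ratios `M (r + e_i) / M r` of a system of moments. If `M` is the system of moments of the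
random cell probabilities of a sample, this is the prediction rule of the sample. -/
def predictive [DecidableEq ι] (M : (ι → ℕ) → ℝ) (r : ι → ℕ) (i : ι) : ℝ :=
  M (r + Pi.single i 1) / M r

/-- A random vector of positive numbers with sum `1`, indexed by a finite type which need not be
a set of cells as in `IsRandomProbability`. -/
structure IsRandomWeights (μ : Measure Ω) (q : Ω → ι → ℝ) : Prop where
  measurable : Measurable q
  pos : ∀ᵐ ω ∂μ, ∀ i, 0 < q ω i
  sum_eq_one : ∀ᵐ ω ∂μ, ∑ i, q ω i = 1

variable {μ : Measure Ω} {q : Ω → ι → ℝ}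

theorem IsRandomWeights.map {κ : Type*} [Fintype κ] (hq : IsRandomWeights μ q) {f : ι → κ}
    (hf : f.Surjective) : IsRandomWeights μ fun ω => FunOnFinite.map f (q ω) where
  measurable := (FunOnFinite.continuous_map ℝ f).measurable.comp hq.measurable
  pos := by
    filter_upwards [hq.pos] with ω hω
    exact map_pos hf hω
  sum_eq_one := by
    filter_upwards [hq.sum_eq_one] with ω hω
    rw [sum_map, hω]

theorem prod_pow_add_single [DecidableEq ι] {R : Type*} [CommMonoid R] (x : ι → R) (r : ι → ℕ)
    (i : ι) : ∏ j, x j ^ (r + Pi.single i 1 : ι → ℕ) j = (∏ j, x j ^ r j) * x i := by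
  simp only [Pi.add_apply, pow_add, Finset.prod_mul_distrib, Pi.single_apply, pow_ite, pow_one,
    pow_zero, Finset.prod_ite_eq', Finset.mem_univ, if_true]

theorem mixedMoment_zero [IsProbabilityMeasure μ] : mixedMoment μ q 0 = 1 := by
  simp [mixedMoment]

theorem mixedMoment_add_single [DecidableEq ι] (r : ι → ℕ) (i : ι) :
    mixedMoment μ q (r + Pi.single i 1) = ∫ ω, (∏ j, q ω j ^ r j) * q ω i ∂μ := by
  simp only [mixedMoment, prod_pow_add_single]

theorem mixedMoment_single [DecidableEq ι] (i : ι) :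
    mixedMoment μ q (Pi.single i 1) = mean μ q i := by
  simpa [mean] using mixedMoment_add_single (μ := μ) (q := q) 0 i

theorem predictive_mixedMoment_zero [DecidableEq ι] [IsProbabilityMeasure μ] :
    predictive (mixedMoment μ q) 0 = mean μ q := by
  ext i
  rw [predictive, mixedMoment_zero, zero_add, div_one, mixedMoment_single]

theorem mixedMoment_congr {q' : Ω → ι → ℝ} (h : q =ᵐ[μ] q') :
    mixedMoment μ q = mixedMoment μ q' := by
  ext r
  exact integral_congr_ae (h.mono fun ω hω => by simp only [hω])

namespace IsRandomWeights

theorem integrable_monomial [IsFiniteMeasure μ] (hq : IsRandomWeights μ q) (r : ι → ℕ) :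
    Integrable (fun ω => ∏ i, q ω i ^ r i) μ := by
  have := hq.measurable
  refine Integrable.of_bound (C := 1) (Measurable.aestronglyMeasurable (by fun_prop)) ?_
  filter_upwards [hq.pos, hq.sum_eq_one] with ω hpos hsum
  have hle (i : ι) : q ω i ≤ 1 :=
    hsum ▸ Finset.single_le_sum (fun j _ => (hpos j).le) (Finset.mem_univ i)
  rw [Real.norm_of_nonneg (Finset.prod_nonneg fun i _ => pow_nonneg (hpos i).le _)]
  exact Finset.prod_le_one (fun i _ => pow_nonneg (hpos i).le _) fun i _ =>
    pow_le_one₀ (hpos i).le (hle i)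

theorem integrable [IsFiniteMeasure μ] (hq : IsRandomWeights μ q) (i : ι) :
    Integrable (fun ω => q ω i) μ := by
  classical
  simpa [Pi.single_apply] using hq.integrable_monomial (Pi.single i 1)

theorem mean_map [IsFiniteMeasure μ] (hq : IsRandomWeights μ q) {κ : Type*} [Finite κ]
    (f : ι → κ) : mean μ (fun ω => FunOnFinite.map f (q ω)) = FunOnFinite.map f (mean μ q) := by
  classical
  cases nonempty_fintype κ
  ext k
  simp only [mean, FunOnFinite.map_apply_apply]
  exact integral_finsetSum _ fun i _ => hq.integrable i

theorem mixedMoment_pos [IsProbabilityMeasure μ] (hq : IsRandomWeights μ q) (r : ι → ℕ) :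
    0 < mixedMoment μ q r := by
  have hpos : ∀ᵐ ω ∂μ, 0 < ∏ i, q ω i ^ r i :=
    hq.pos.mono fun ω hω => Finset.prod_pos fun i _ => pow_pos (hω i) _
  have hsupp : Function.support (fun ω => ∏ i, q ω i ^ r i) =ᵐ[μ] Set.univ :=
    hpos.mono fun ω hω => eq_true hω.ne'
  rw [mixedMoment, integral_pos_iff_support_of_nonneg_ae (hpos.mono fun ω hω => hω.le)
    (hq.integrable_monomial r), measure_congr hsupp, measure_univ]
  exact one_pos

theorem mean_pos [IsProbabilityMeasure μ] (hq : IsRandomWeights μ q) (i : ι) : 0 < mean μ q i := by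
  classical
  rw [← mixedMoment_single]
  exact hq.mixedMoment_pos _

theorem sum_mixedMoment_add_single [DecidableEq ι] [IsFiniteMeasure μ] (hq : IsRandomWeights μ q)
    (r : ι → ℕ) : ∑ i, mixedMoment μ q (r + Pi.single i 1) = mixedMoment μ q r := by
  simp only [mixedMoment]
  rw [← integral_finsetSum _ fun i _ => hq.integrable_monomial _]
  refine integral_congr_ae ?_
  filter_upwards [hq.sum_eq_one] with ω hω
  simp only [prod_pow_add_single]
  rw [← Finset.mul_sum, hω, mul_one]

theorem isPredictionRule [DecidableEq ι] [IsProbabilityMeasure μ] (hq : IsRandomWeights μ q) :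
    IsPredictionRule (predictive (mixedMoment μ q)) where
  pos r i := div_pos (hq.mixedMoment_pos _) (hq.mixedMoment_pos r)
  sum_eq_one r := by
    simp only [predictive]
    rw [← Finset.sum_div, hq.sum_mixedMoment_add_single, div_self (hq.mixedMoment_pos r).ne']

/-- Without reinforcement the second moment of each weight is the square of its mean. -/
theorem ae_eq_mean_of_isPolya_zero [DecidableEq ι] [IsProbabilityMeasure μ]
    (hq : IsRandomWeights μ q) {b : ι → ℝ} (hb : ∑ i, b i ≠ 0)
    (h : IsPolya (predictive (mixedMoment μ q)) b 0) : ∀ᵐ ω ∂μ, q ω = mean μ q := by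
  simp only [funext_iff, ae_all_iff]
  intro i
  have hLp : MemLp (fun ω => q ω i) 2 μ := by
    refine MemLp.of_bound (measurable_pi_iff.1 hq.measurable i).aestronglyMeasurable 1 ?_
    filter_upwards [hq.pos, hq.sum_eq_one] with ω hpos hsum
    rw [Real.norm_of_nonneg (hpos i).le, ← hsum]
    exact Finset.single_le_sum (fun j _ => (hpos j).le) (Finset.mem_univ i)
  have predictive_eq (r : ι → ℕ) : predictive (mixedMoment μ q) r i = b i / ∑ j, b j :=
    eq_div_of_mul_eq hb (by simpa using h r i)
  have hsq : ∫ ω, q ω i ^ 2 ∂μ = mean μ q i ^ 2 := by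
    have hi := (predictive_eq (Pi.single i 1)).trans (predictive_eq 0).symm
    rw [predictive_mixedMoment_zero, predictive, div_eq_iff (hq.mixedMoment_pos _).ne',
      mixedMoment_add_single, mixedMoment_single, ← sq] at hi
    rw [← hi]
    simp [Pi.single_apply, pow_ite, sq]
  refine ae_eq_integral_of_variance_eq_zero hLp ?_
  rw [variance_eq_sub hLp]
  exact sub_eq_zero.2 hsq

end IsRandomWeights

section TwoWay

variable {K L : Type*} [Fintype K] [Fintype L] [DecidableEq K] [DecidableEq L]

theorem factorsByRow_predictive {M : (K × L → ℕ) → ℝ} {f : (K → ℕ) → ℝ} {F : K → (L → ℕ) → ℝ}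
    (hF : ∀ k s, F k s ≠ 0)
    (hM : ∀ r, M r = f (FunOnFinite.map Prod.fst r) * ∏ k, F k fun l => r (k, l)) :
    FactorsByRow (predictive M) (predictive f) fun k => predictive (F k) := by
  intro r k l
  have row_self : (fun l' => (r + Pi.single (k, l) 1 : K × L → ℕ) (k, l')) =
      (fun l' => r (k, l')) + Pi.single l 1 := by
    ext l'
    simp [Pi.single_apply]
  have row_of_ne (k' : K) (hk' : k' ∈ Finset.univ.erase k) :
      F k' (fun l' => (r + Pi.single (k, l) 1 : K × L → ℕ) (k', l')) =
        F k' fun l' => r (k', l') := by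
    simp [Finset.ne_of_mem_erase hk']
  have other_rows : ∏ k' ∈ Finset.univ.erase k, F k' (fun l => r (k', l)) ≠ 0 :=
    Finset.prod_ne_zero_iff.2 fun k' _ => hF k' _
  simp only [predictive]
  rw [hM, hM r, ← Finset.mul_prod_erase _ _ (Finset.mem_univ k),
    ← Finset.mul_prod_erase _ (fun k => F k fun l => r (k, l)) (Finset.mem_univ k),
    Finset.prod_congr rfl row_of_ne, row_self, map_add, FunOnFinite.map_piSingle, ← mul_assoc,
    ← mul_assoc, mul_div_mul_right _ _ other_rows, mul_div_mul_comm]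

theorem transposeRule_predictive_mixedMoment (q : Ω → K × L → ℝ) :
    transposeRule (predictive (mixedMoment μ q)) =
      predictive (mixedMoment μ fun ω => FunOnFinite.map Prod.swap (q ω)) := by
  have map_swap (r : L × K → ℕ) : mixedMoment μ q (FunOnFinite.map Prod.swap r) =
      mixedMoment μ (fun ω => FunOnFinite.map Prod.swap (q ω)) r := by
    refine integral_congr_ae (.of_forall fun ω => ?_)
    simp only [map_swap_apply]
    exact ((Equiv.prodComm L K).prod_comp _).symm
  ext r x
  rw [transposeRule, predictive, predictive, ← map_swap, ← map_swap, map_add,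
    FunOnFinite.map_piSingle]

end TwoWay

end Moments

section Independence

variable {K L Ω : Type*} [Fintype K] [Fintype L] {m₁ m₂ mΩ : MeasurableSpace Ω} {μ : Measure Ω}

theorem integral_mul_of_indep (hm₁ : m₁ ≤ mΩ)
    (hm₂ : m₂ ≤ mΩ) (h : Indep m₁ m₂ μ) {X Y : Ω → ℝ}
    (hX : AEStronglyMeasurable[m₁] X μ) (hY : AEStronglyMeasurable[m₂] Y μ) :
    ∫ ω, X ω * Y ω ∂μ = (∫ ω, X ω ∂μ) * ∫ ω, Y ω ∂μ := by
  have hXY : (hX.mk X) ⟂ᵢ[μ] (hY.mk Y) := by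
    rw [IndepFun_iff_Indep]
    exact indep_of_indep_of_le h hX.stronglyMeasurable_mk.measurable.comap_le
      hY.stronglyMeasurable_mk.measurable.comap_le
  exact (hXY.congr hX.ae_eq_mk.symm hY.ae_eq_mk.symm).integral_fun_mul_eq_mul_integral
    (hX.mono hm₁) (hY.mono hm₂)

theorem mixedMoment_two_way (hm₁ : m₁ ≤ mΩ)
    (hm₂ : m₂ ≤ mΩ) (h : Indep m₁ m₂ μ) {q : Ω → K × L → ℝ} {T : Ω → K → ℝ}
    {R : K → Ω → L → ℝ} (hq : ∀ᵐ ω ∂μ, ∀ k l, q ω (k, l) = T ω k * R k ω l)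
    (hT : ∀ k, AEStronglyMeasurable[m₁] (fun ω => T ω k) μ) (hR : ∀ k, Measurable[m₂] (R k))
    (hRindep : iIndepFun R μ) (r : K × L → ℕ) :
    mixedMoment μ q r = mixedMoment μ T (FunOnFinite.map Prod.fst r) *
      ∏ k, mixedMoment μ (R k) fun l => r (k, l) := by
  have monomial_eq : ∀ᵐ ω ∂μ, ∏ x, q ω x ^ r x =
      (∏ k, T ω k ^ FunOnFinite.map Prod.fst r k) * ∏ k, ∏ l, R k ω l ^ r (k, l) := by
    filter_upwards [hq] with ω hω
    rw [Fintype.prod_prod_type, ← Finset.prod_mul_distrib]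
    refine Finset.prod_congr rfl fun k _ => ?_
    simp only [hω, mul_pow, Finset.prod_mul_distrib, Finset.prod_pow_eq_pow_sum, map_fst_apply]
  have rows : ∫ ω, ∏ k, ∏ l, R k ω l ^ r (k, l) ∂μ = ∏ k, mixedMoment μ (R k) fun l => r (k, l) :=
    hRindep.integral_fun_prod_comp (𝕜 := ℝ) (f := fun k b => ∏ l, b l ^ r (k, l))
      (fun k => ((hR k).mono hm₂ le_rfl).aemeasurable) fun k =>
        Measurable.aestronglyMeasurable (by fun_prop)
  rw [mixedMoment, integral_congr_ae monomial_eq, integral_mul_of_indep hm₁ hm₂ h, rows]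
  · rfl
  · simpa only [Finset.prod_fn] using
      Finset.prod_induction (fun k ω => T ω k ^ FunOnFinite.map Prod.fst r k)
        (AEStronglyMeasurable[m₁] · μ) (fun _ _ hX hY => hX.mul hY)
        stronglyMeasurable_one.aestronglyMeasurable fun k _ => (hT k).fun_pow _
  · refine Measurable.aestronglyMeasurable (Finset.measurable_fun_prod _ fun k _ =>
      Finset.measurable_fun_prod _ fun l _ => Measurable.pow_const ?_ _)
    exact (measurable_pi_apply l).comp (hR k)

end Independence

/-! ### Marginal and conditional tables -/

section Cells

variable {V : Type*} {I : V → Type*}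

/-- The cells of a set consisting of a single variable `u` are the values of `u`. -/
def singletonCellEquiv {A : Finset V} {u : V} (hA : A = {u}) : I u ≃ ((a : A) → I a) :=
  by subst hA; exact (Equiv.piUnique fun a : ({u} : Finset V) => I a).symm

theorem singletonCellEquiv_apply {A : Finset V} {u : V} (hA : A = {u}) (i : (v : V) → I v) :
    singletonCellEquiv hA (i u) = A.restrict i := by
  subst hA
  exact (Equiv.symm_apply_eq _).2 rfl

variable [∀ v, Nonempty (I v)]

theorem surjective_restrict_prodMk {A : Finset V} {v : V} (hv : v ∉ A) :
    Function.Surjective fun i : (w : V) → I w => (A.restrict i, i v) := by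
  classical
  rintro ⟨k, m⟩
  refine ⟨Function.update (fun w => if h : w ∈ A then k ⟨w, h⟩ else Classical.arbitrary _) v m,
    Prod.ext (funext fun a => ?_) (by simp)⟩
  simp [ne_of_mem_of_not_mem a.2 hv]

theorem surjective_eval_prodMk_eval {u v : V} (huv : u ≠ v) :
    Function.Surjective fun i : (w : V) → I w => (i u, i v) := by
  classical
  rintro ⟨k, m⟩
  refine ⟨Function.update (Function.update (fun w => Classical.arbitrary _) u k) v m, ?_⟩
  simp [huv]

end Cells

section Marginals

variable {V : Type*} [Fintype V] {I : V → Type*} [∀ v, Fintype (I v)] {M : Type*} [AddCommMonoid M]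

/-- The one-way marginal of a table at the variable `u`. -/
def vertexTable (x : ((v : V) → I v) → M) (u : V) : I u → M :=
  FunOnFinite.map (fun i => i u) x

/-- The two-way marginal of a table at the variables `u` and `v`. -/
def edgeTable (x : ((v : V) → I v) → M) (u v : V) : I u × I v → M :=
  FunOnFinite.map (fun i => (i u, i v)) x

/-- The numerators `x (X_A = k, X_v = m)` of the conditional probabilities of `v` given the cell
`k` of a set `A`, in applications the set of parents of `v`. -/
def familyTable (x : ((v : V) → I v) → M) (v : V) (A : Finset V) (k : (a : A) → I a) (m : I v) :
    M :=
  FunOnFinite.map (fun i => (A.restrict i, i v)) x (k, m)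

theorem map_fst_edgeTable (x : ((v : V) → I v) → M) (u v : V) :
    FunOnFinite.map Prod.fst (edgeTable x u v) = vertexTable x u :=
  map_map _ _ x

theorem map_swap_edgeTable (x : ((v : V) → I v) → M) (u v : V) :
    FunOnFinite.map Prod.swap (edgeTable x u v) = edgeTable x v u :=
  map_map _ _ x

theorem sum_edgeTable (x : ((v : V) → I v) → M) (u v : V) (k : I u) :
    ∑ m, edgeTable x u v (k, m) = vertexTable x u k := by
  rw [← map_fst_edgeTable x u v, map_fst_apply]

theorem familyTable_singleton (x : ((v : V) → I v) → M) {A : Finset V} {u v : V} (hA : A = {u})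
    (k : I u) (m : I v) :
    familyTable x v A (singletonCellEquiv hA k) m = edgeTable x u v (k, m) := by
  have hinj : Function.Injective (Prod.map (singletonCellEquiv (I := I) hA) (id : I v → I v)) :=
    (singletonCellEquiv hA).injective.prodMap Function.injective_id
  simpa only [edgeTable, familyTable, map_map, Prod.map_apply, singletonCellEquiv_apply, id] using
    map_apply_of_injective hinj (edgeTable x u v) (k, m)

theorem familyTable_empty (x : ((v : V) → I v) → M) (v : V) {A : Finset V} (hA : A = ∅)
    (k : (a : A) → I a) (m : I v) : familyTable x v A k m = vertexTable x v m := by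
  have restrict_eq (i : (v : V) → I v) : A.restrict i = k := by
    subst hA
    exact Subsingleton.elim _ _
  simpa only [vertexTable, map_map, familyTable, restrict_eq] using
    map_apply_of_injective (Prod.mk_right_injective k) (vertexTable x v) m

theorem vertexTable_pos [∀ v, Nonempty (I v)] {x : ((v : V) → I v) → ℝ} (hx : ∀ i, 0 < x i)
    (u : V) (k : I u) : 0 < vertexTable x u k :=
  map_pos (Function.surjective_eval u) hx k

theorem familyTable_pos [∀ v, Nonempty (I v)] {x : ((v : V) → I v) → ℝ} (hx : ∀ i, 0 < x i)
    {v : V} {A : Finset V} (hv : v ∉ A) (k : (a : A) → I a) (m : I v) :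
    0 < familyTable x v A k m :=
  map_pos (surjective_restrict_prodMk hv) hx (k, m)

theorem familyTable_add_natCast (x : ((v : V) → I v) → ℝ) (r : ((v : V) → I v) → ℕ) (v : V)
    (A : Finset V) (k : (a : A) → I a) (m : I v) :
    familyTable (fun i => x i + r i) v A k m =
      familyTable x v A k m + (familyTable r v A k m : ℕ) :=
  (congrFun (map_add _ x fun i => (r i : ℝ)) (k, m)).trans <|
    congrArg (_ + ·) (map_addMonoidHom_comp (Nat.castAddMonoidHom ℝ) _ r (k, m))

theorem familyTable_const_mul (d : ℝ) (x : ((v : V) → I v) → ℝ) (v : V) (A : Finset V)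
    (k : (a : A) → I a) (m : I v) :
    familyTable (fun i => d * x i) v A k m = d * familyTable x v A k m :=
  map_addMonoidHom_comp (AddMonoidHom.mulLeft d) _ x (k, m)

variable [∀ v, DecidableEq (I v)]

theorem familyTable_add_single (r : ((v : V) → I v) → ℕ) (i : (v : V) → I v) (v : V)
    (A : Finset V) : familyTable (r + Pi.single i 1) v A (A.restrict i) =
      familyTable r v A (A.restrict i) + Pi.single (i v) 1 := by
  classical
  ext m
  simp only [familyTable, map_add, FunOnFinite.map_piSingle, Pi.add_apply, Pi.single_apply,
    Prod.mk.injEq, true_and]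

theorem familyTable_add_single_of_ne (r : ((v : V) → I v) → ℕ) (i : (v : V) → I v) (v : V)
    (A : Finset V) {k : (a : A) → I a} (hk : k ≠ A.restrict i) :
    familyTable (r + Pi.single i 1) v A k = familyTable r v A k := by
  classical
  ext m
  simp [familyTable, map_add, FunOnFinite.map_piSingle, hk]

variable [DecidableEq V]

theorem marginal_eq_map (x : ((v : V) → I v) → M) (A : Finset V) :
    marginal x A = FunOnFinite.map A.restrict x := by
  ext k
  rw [marginal, FunOnFinite.map_apply_apply]

theorem marginal_empty (x : ((v : V) → I v) → M) {A : Finset V} (hA : A = ∅)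
    (k : (a : A) → I a) : marginal x A k = ∑ i, x i := by
  subst hA
  simp [marginal, Subsingleton.elim _ k]

theorem marginal_singleton (x : ((v : V) → I v) → M) {A : Finset V} {u : V}
    (hA : A = {u}) (k : I u) : marginal x A (singletonCellEquiv hA k) = vertexTable x u k := by
  simpa only [vertexTable, map_map, singletonCellEquiv_apply, ← marginal_eq_map] using
    map_apply_of_injective (singletonCellEquiv hA).injective (vertexTable x u) k

theorem marginal_pair (x : ((v : V) → I v) → M) {u v : V} (i : (v : V) → I v) :
    marginal x {u, v} (Finset.restrict {u, v} i) = edgeTable x u v (i u, i v) := by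
  have restrict_eq_iff (j : (v : V) → I v) :
      Finset.restrict {u, v} j = Finset.restrict {u, v} i ↔ (j u, j v) = (i u, i v) := by
    simp [funext_iff]
  simp only [marginal, edgeTable, FunOnFinite.map_apply_apply, restrict_eq_iff]

theorem marginal_pos [∀ v, Nonempty (I v)] {x : ((v : V) → I v) → ℝ} (hx : ∀ i, 0 < x i)
    (A : Finset V) (k : (a : A) → I a) : 0 < marginal x A k := by
  rw [marginal_eq_map]
  exact map_pos (Subtype.surjective_restrict (· ∈ A)) hx k

theorem marginal_add_natCast (x : ((v : V) → I v) → ℝ) (r : ((v : V) → I v) → ℕ)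
    (A : Finset V) (k : (a : A) → I a) :
    marginal (fun i => x i + r i) A k = marginal x A k + (marginal r A k : ℕ) := by
  simp [marginal, Finset.sum_add_distrib]

theorem marginal_add_single (x : ((v : V) → I v) → ℝ) (i : (v : V) → I v) (A : Finset V) :
    marginal (x + Pi.single i 1) A = marginal x A + Pi.single (A.restrict i) 1 := by
  simp only [marginal_eq_map, map_add, FunOnFinite.map_piSingle]

theorem sum_familyTable (x : ((v : V) → I v) → M) (v : V) (A : Finset V) (k : (a : A) → I a) :
    ∑ m, familyTable x v A k m = marginal x A k := by
  simp only [familyTable, ← map_fst_apply, map_map, marginal_eq_map]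

theorem condProb_eq_div (x : ((v : V) → I v) → ℝ) (v : V) (A : Finset V) (k : (a : A) → I a)
    (m : I v) : condProb x v A k m = familyTable x v A k m / marginal x A k := by
  simp only [condProb, familyTable, FunOnFinite.map_apply_apply, Prod.mk.injEq]

theorem condProb_empty {x : ((v : V) → I v) → ℝ} (hx : ∑ i, x i = 1) (v : V) {A : Finset V}
    (hA : A = ∅) (k : (a : A) → I a) : condProb x v A k = vertexTable x v := by
  ext m
  rw [condProb_eq_div, familyTable_empty x v hA, marginal_empty x hA, hx, div_one]

theorem edgeTable_eq_mul_condProb {x : ((v : V) → I v) → ℝ} {A : Finset V} {u v : V}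
    (hA : A = {u}) {k : I u} (hk : vertexTable x u k ≠ 0) (m : I v) :
    edgeTable x u v (k, m) = vertexTable x u k * condProb x v A (singletonCellEquiv hA k) m := by
  rw [condProb_eq_div, familyTable_singleton, marginal_singleton, mul_div_cancel₀ _ hk]

end Marginals

/-! ### Independent conditional probabilities -/

section Forest

variable {V : Type*} {pa : V → Finset V} {rank : V → ℕ}

/-- `pa` is the parent function of a directed forest along whose edges `rank` increases. -/
def IsForestRank (pa : V → Finset V) (rank : V → ℕ) : Prop :=
  ∀ v, pa v = ∅ ∨ ∃ u, pa v = {u} ∧ rank u < rank v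

theorem IsForestRank.notMem (h : IsForestRank pa rank) (v : V) : v ∉ pa v := by
  rcases h v with h₀ | ⟨u, hu, hlt⟩
  · simp [h₀]
  · rw [hu, Finset.mem_singleton]
    rintro rfl
    exact hlt.false

theorem IsForestRank.rank_lt (h : IsForestRank pa rank) {u v : V} (huv : pa v = {u}) :
    rank u < rank v := by
  rcases h v with h₀ | ⟨w, hw, hlt⟩
  · exact absurd (huv.symm.trans h₀) (Finset.singleton_ne_empty u)
  · rwa [Finset.singleton_injective (huv.symm.trans hw)]

end Forest

section ConditionalVectors

variable {V : Type*} [Fintype V] [DecidableEq V] {I : V → Type*} [∀ v, Fintype (I v)]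

namespace IsRandomProbability

variable {Ω : Type*} [MeasurableSpace Ω] {μ : Measure Ω} {p : Ω → ((v : V) → I v) → ℝ}

theorem isRandomWeights (hp : IsRandomProbability μ p) : IsRandomWeights μ p where
  measurable := measurable_pi_lambda p hp.measurable
  pos := hp.pos
  sum_eq_one := hp.sum_eq_one

theorem nonempty_cell [NeZero μ] (hp : IsRandomProbability μ p) :
    Nonempty ((v : V) → I v) := by
  obtain ⟨ω, hω⟩ := hp.sum_eq_one.exists
  by_contra! h
  simp at hω

end IsRandomProbability

variable [∀ v, DecidableEq (I v)] {Ω : Type*} {p : Ω → ((v : V) → I v) → ℝ} {pa : V → Finset V}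

/-- The random vector of the conditional probabilities of the variable `s.1` given that its parents
are in the cell `s.2`. -/
def condVector (p : Ω → ((v : V) → I v) → ℝ) (pa : V → Finset V)
    (s : Σ v : V, ((a : pa v) → I a)) (ω : Ω) (m : I s.1) : ℝ :=
  condProb (p ω) s.1 (pa s.1) s.2 m

/-- The σ-algebra generated by the conditional probabilities of the variables in `S`. -/
abbrev condSigma (p : Ω → ((v : V) → I v) → ℝ) (pa : V → Finset V) (S : Set V) :
    MeasurableSpace Ω :=
  ⨆ s ∈ {s : Σ v : V, ((a : pa v) → I a) | s.1 ∈ S},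
    MeasurableSpace.comap (condVector p pa s) inferInstance

theorem measurable_condVector_condSigma {S : Set V} {s : Σ v : V, ((a : pa v) → I a)}
    (hs : s.1 ∈ S) : Measurable[condSigma p pa S] (condVector p pa s) :=
  (comap_measurable _).mono (le_iSup₂_of_le s hs le_rfl) le_rfl

variable {mΩ : MeasurableSpace Ω} {μ : Measure Ω} {rank : V → ℕ}

namespace IsRandomProbability

theorem measurable_condVector (hp : IsRandomProbability μ p) (s : Σ v : V, ((a : pa v) → I a)) :
    Measurable (condVector p pa s) := by
  refine measurable_pi_lambda _ fun m => ?_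
  exact (Finset.measurable_fun_sum _ fun i _ => hp.measurable i).div
    (Finset.measurable_fun_sum _ fun i _ => hp.measurable i)

theorem condSigma_le (hp : IsRandomProbability μ p) (S : Set V) : condSigma p pa S ≤ mΩ :=
  iSup₂_le fun s _ => (hp.measurable_condVector s).comap_le

end IsRandomProbability

theorem indep_condSigma (hp : IsRandomProbability μ p) (h : iIndepFun (condVector p pa) μ)
    {S T : Set V} (hST : Disjoint S T) : Indep (condSigma p pa S) (condSigma p pa T) μ :=
  indep_iSup_of_disjoint (fun s => (hp.measurable_condVector s).comap_le) h.iIndep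
    (hST.preimage Sigma.fst)

variable [∀ v, Nonempty (I v)]

theorem isRandomWeights_condVector (hp : IsRandomProbability μ p)
    (s : Σ v : V, ((a : pa v) → I a)) (hs : s.1 ∉ pa s.1) :
    IsRandomWeights μ (condVector p pa s) where
  measurable := hp.measurable_condVector s
  pos := by
    filter_upwards [hp.pos] with ω hω m
    rw [condVector, condProb_eq_div]
    exact div_pos (familyTable_pos hω hs _ _) (marginal_pos hω _ _)
  sum_eq_one := by
    filter_upwards [hp.pos] with ω hω
    simp only [condVector, condProb_eq_div]
    rw [← Finset.sum_div, sum_familyTable, div_self (marginal_pos hω _ _).ne']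

theorem aestronglyMeasurable_vertexTable (hp : IsRandomProbability μ p)
    (hpa : IsForestRank pa rank) {n : ℕ} {v : V} (hv : rank v < n) (m : I v) :
    AEStronglyMeasurable[condSigma p pa {w | rank w < n}] (fun ω => vertexTable (p ω) v m) μ := by
  have condVector_meas (k : (a : pa v) → I a) :
      AEStronglyMeasurable[condSigma p pa {w | rank w < n}]
        (fun ω => condVector p pa ⟨v, k⟩ ω m) μ :=
    ((measurable_pi_apply m).comp
      (measurable_condVector_condSigma (s := ⟨v, k⟩) hv)).aestronglyMeasurable
  induction hr : rank v using Nat.strong_induction_on generalizing v with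
  | _ N ih =>
    rcases hpa v with h₀ | ⟨u, hu, hlt⟩
    · refine (condVector_meas fun _ => Classical.arbitrary _).congr ?_
      filter_upwards [hp.sum_eq_one] with ω hω
      rw [condVector, condProb_empty hω v h₀]
    · have parent_meas (k : I u) := ih (rank u) (hr ▸ hlt) (hlt.trans hv) k
        (fun s => ((measurable_pi_apply k).comp
          (measurable_condVector_condSigma (s := ⟨u, s⟩) (hlt.trans hv))).aestronglyMeasurable) rfl
      have sum_meas := Finset.sum_induction
        (fun k ω => vertexTable (p ω) u k * condVector p pa ⟨v, singletonCellEquiv hu k⟩ ω m)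
        (AEStronglyMeasurable[condSigma p pa {w | rank w < n}] · μ) (fun _ _ hX hY => hX.add hY)
        stronglyMeasurable_zero.aestronglyMeasurable
        fun k (_ : k ∈ Finset.univ) => (parent_meas k).mul (condVector_meas _)
      refine sum_meas.congr ?_
      filter_upwards [hp.pos] with ω hω
      rw [← sum_edgeTable (p ω) v u m, ← map_swap_edgeTable, Finset.sum_apply]
      refine Finset.sum_congr rfl fun k _ => ?_
      rw [map_swap_apply, Prod.swap_prod_mk,
        edgeTable_eq_mul_condProb hu (vertexTable_pos hω u k).ne', condVector]

variable [IsProbabilityMeasure μ]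

/-- The marginal of a vertex is a function of the conditional probabilities of the vertices of at
most the same rank, hence independent of the conditional probabilities of its children. -/
theorem factorsByRow_edgeTable (hp : IsRandomProbability μ p) (h : iIndepFun (condVector p pa) μ)
    (hpa : IsForestRank pa rank) {u v : V} (huv : pa v = {u}) :
    FactorsByRow (predictive (mixedMoment μ fun ω => edgeTable (p ω) u v))
      (predictive (mixedMoment μ fun ω => vertexTable (p ω) u)) fun k =>
        predictive (mixedMoment μ (condVector p pa ⟨v, singletonCellEquiv huv k⟩)) := by
  have row_injective : Function.Injective fun k =>
      (⟨v, singletonCellEquiv huv k⟩ : Σ v : V, ((a : pa v) → I a)) :=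
    sigma_mk_injective.comp (singletonCellEquiv huv).injective
  have disjoint : Disjoint {w | rank w < rank v} {v} := by simp
  have rows_ne_zero (k : I u) (s : I v → ℕ) :
      mixedMoment μ (condVector p pa ⟨v, singletonCellEquiv huv k⟩) s ≠ 0 :=
    ((isRandomWeights_condVector hp ⟨v, _⟩ (hpa.notMem v)).mixedMoment_pos s).ne'
  have rows_indep : iIndepFun (fun k => condVector p pa ⟨v, singletonCellEquiv huv k⟩) μ :=
    h.precomp row_injective
  have edge_eq_mul : ∀ᵐ ω ∂μ, ∀ k m, edgeTable (p ω) u v (k, m) =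
      vertexTable (p ω) u k * condVector p pa ⟨v, singletonCellEquiv huv k⟩ ω m := by
    filter_upwards [hp.pos] with ω hω k m
    exact edgeTable_eq_mul_condProb huv (vertexTable_pos hω u k).ne' m
  exact factorsByRow_predictive rows_ne_zero <| mixedMoment_two_way
    (hp.condSigma_le _) (hp.condSigma_le _) (indep_condSigma hp h disjoint) edge_eq_mul
    (fun k => aestronglyMeasurable_vertexTable hp hpa (hpa.rank_lt huv) k)
    (fun k => measurable_condVector_condSigma rfl) rows_indep

end ConditionalVectors

section Edges

variable {V : Type*} [Fintype V] {I : V → Type*} [∀ v, Fintype (I v)]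
  [∀ v, DecidableEq (I v)] {Ω : Type*} [MeasurableSpace Ω] {μ : Measure Ω}
  {p : Ω → ((v : V) → I v) → ℝ}

theorem isPolya_edgeTable_swap {u v : V} {b : ((v : V) → I v) → ℝ} {c : ℝ}
    (h : IsPolya (predictive (mixedMoment μ fun ω => edgeTable (p ω) u v)) (edgeTable b u v) c) :
    IsPolya (predictive (mixedMoment μ fun ω => edgeTable (p ω) v u)) (edgeTable b v u) c := by
  simpa only [transposeRule_predictive_mixedMoment, map_swap_edgeTable, ← map_swap_apply]
    using h.transpose

variable [DecidableEq V] [∀ v, Nonempty (I v)] [IsProbabilityMeasure μ] {pa pb : V → Finset V}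
  {rank rank' : V → ℕ} {u v : V} {b : ((v : V) → I v) → ℝ} {c : ℝ}

theorem isPolya_vertexTable_of_edgeTable (hp : IsRandomProbability μ p)
    (h : iIndepFun (condVector p pa) μ) (hpa : IsForestRank pa rank) (huv : pa v = {u})
    (hpolya : IsPolya (predictive (mixedMoment μ fun ω => edgeTable (p ω) u v))
      (edgeTable b u v) c) :
    IsPolya (predictive (mixedMoment μ fun ω => vertexTable (p ω) u)) (vertexTable b u) c := by
  simpa only [sum_edgeTable] using (factorsByRow_edgeTable hp h hpa huv).isPolya_row_totals
    (fun k => (isRandomWeights_condVector hp ⟨v, _⟩ (hpa.notMem v)).isPredictionRule) hpolya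

theorem isPolya_condVector_of_edgeTable (hp : IsRandomProbability μ p)
    (h : iIndepFun (condVector p pa) μ) (hpa : IsForestRank pa rank) (huv : pa v = {u})
    (hpolya : IsPolya (predictive (mixedMoment μ fun ω => edgeTable (p ω) u v))
      (edgeTable b u v) c) (k : (a : pa v) → I a) :
    IsPolya (predictive (mixedMoment μ (condVector p pa ⟨v, k⟩))) (familyTable b v (pa v) k) c := by
  obtain ⟨k, rfl⟩ := (singletonCellEquiv huv).surjective k
  have row_polya := (factorsByRow_edgeTable hp h hpa huv).isPolya_row
    (fun k => (isRandomWeights_condVector hp ⟨v, _⟩ (hpa.notMem v)).isPredictionRule) hpolya k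
  rwa [← funext (familyTable_singleton b huv k)] at row_polya

theorem exists_isPolya_edgeTable [Nontrivial (I u)] [Nontrivial (I v)]
    (hp : IsRandomProbability μ p) (ha : iIndepFun (condVector p pa) μ)
    (hpa : IsForestRank pa rank) (hb : iIndepFun (condVector p pb) μ)
    (hpb : IsForestRank pb rank') (huv : pa v = {u}) (hvu : pb u = {v}) :
    ∃ c, 0 ≤ c ∧ IsPolya (predictive (mixedMoment μ fun ω => edgeTable (p ω) u v))
      (edgeTable (mean μ p) u v) c := by
  have ne : u ≠ v := by
    rintro rfl
    exact (hpa.rank_lt huv).false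
  have weights : IsRandomWeights μ fun ω => edgeTable (p ω) u v :=
    hp.isRandomWeights.map (surjective_eval_prodMk_eval ne)
  have column_factors := factorsByRow_edgeTable hp hb hpb hvu
  simp only [← map_swap_edgeTable _ u v, ← transposeRule_predictive_mixedMoment] at column_factors
  have polya := exists_isPolya_of_factorsByRow weights.isPredictionRule
    (factorsByRow_edgeTable hp ha hpa huv) column_factors
  have mean_eq : mean μ (fun ω => edgeTable (p ω) u v) = edgeTable (mean μ p) u v :=
    hp.isRandomWeights.mean_map _
  rwa [predictive_mixedMoment_zero, mean_eq] at polya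

end Edges

/-! ### The chain -/

section Chain

variable {n : ℕ}

theorem forwardParents_zero (n : ℕ) : forwardParents (n + 1) 0 = ∅ := by
  simp [forwardParents]

theorem forwardParents_succ (j : Fin n) : forwardParents (n + 1) j.succ = {j.castSucc} := by
  ext i
  simp [forwardParents, Fin.ext_iff]

theorem backwardParents_last (n : ℕ) : backwardParents (n + 1) (Fin.last n) = ∅ := by
  ext i
  simp [backwardParents, i.isLt.ne']

theorem backwardParents_castSucc (j : Fin n) :
    backwardParents (n + 1) j.castSucc = {j.succ} := by
  ext i
  simp [backwardParents, Fin.ext_iff, eq_comm]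

theorem isForestRank_forwardParents (n : ℕ) :
    IsForestRank (forwardParents (n + 1)) fun v => v.val := by
  intro v
  induction v using Fin.cases with
  | zero => exact .inl (forwardParents_zero n)
  | succ j => exact .inr ⟨_, forwardParents_succ j, by simp⟩

theorem isForestRank_backwardParents (n : ℕ) :
    IsForestRank (backwardParents (n + 1)) fun v => v.rev.val := by
  intro v
  induction v using Fin.lastCases with
  | last => exact .inl (backwardParents_last n)
  | cast j => exact .inr ⟨_, backwardParents_castSucc j, Fin.rev_lt_rev.2 Fin.castSucc_lt_succ⟩

section ChainUrns

variable {I : Fin (n + 2) → Type*} [∀ v, Fintype (I v)] [∀ v, DecidableEq (I v)]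
  [∀ v, Nontrivial (I v)] {Ω : Type*} [MeasurableSpace Ω] {μ : Measure Ω} [IsProbabilityMeasure μ]
  {p : Ω → ((v : Fin (n + 2)) → I v) → ℝ}

/-- All edges have the same reinforcement, because adjacent ones share a vertex. -/
theorem exists_forall_isPolya_edgeTable (hp : IsRandomProbability μ p)
    (hforward : iIndepFun (condVector p (forwardParents (n + 2))) μ)
    (hbackward : iIndepFun (condVector p (backwardParents (n + 2))) μ) :
    ∃ c, 0 ≤ c ∧ ∀ j : Fin (n + 1),
      IsPolya (predictive (mixedMoment μ fun ω => edgeTable (p ω) j.castSucc j.succ))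
        (edgeTable (mean μ p) j.castSucc j.succ) c := by
  choose c hc hedge using fun j : Fin (n + 1) =>
    exists_isPolya_edgeTable hp hforward (isForestRank_forwardParents _) hbackward
      (isForestRank_backwardParents _) (forwardParents_succ j) (backwardParents_castSucc j)
  have hsource (j : Fin (n + 1)) := isPolya_vertexTable_of_edgeTable hp hforward
    (isForestRank_forwardParents _) (forwardParents_succ j) (hedge j)
  have htarget (j : Fin (n + 1)) := isPolya_vertexTable_of_edgeTable hp hbackward
    (isForestRank_backwardParents _) (backwardParents_castSucc j) (isPolya_edgeTable_swap (hedge j))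
  have vertex_rule (u : Fin (n + 2)) := (hp.isRandomWeights.map
    (Function.surjective_eval u)).isPredictionRule
  have hvertex (v : Fin (n + 2)) : IsPolya (predictive (mixedMoment μ fun ω => vertexTable (p ω) v))
      (vertexTable (mean μ p) v) (c 0) := by
    induction v using Fin.induction with
    | zero => exact hsource 0
    | succ j ih =>
      rw [ih.reinforcement_unique (vertex_rule _) (hsource j)]
      exact htarget j
  refine ⟨c 0, hc 0, fun j => ?_⟩
  rw [(hvertex _).reinforcement_unique (vertex_rule _) (hsource j)]
  exact hedge j

theorem exists_isPolya_condVector_forwardParents (hp : IsRandomProbability μ p)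
    (hforward : iIndepFun (condVector p (forwardParents (n + 2))) μ)
    (hbackward : iIndepFun (condVector p (backwardParents (n + 2))) μ) :
    ∃ c, 0 ≤ c ∧ ∀ v k,
      IsPolya (predictive (mixedMoment μ (condVector p (forwardParents (n + 2)) ⟨v, k⟩)))
        (familyTable (mean μ p) v (forwardParents (n + 2) v) k) c := by
  obtain ⟨c, hc, hedge⟩ := exists_forall_isPolya_edgeTable hp hforward hbackward
  refine ⟨c, hc, fun v k => ?_⟩
  induction v using Fin.cases with
  | zero =>
    have hroot : condVector p (forwardParents (n + 2)) ⟨0, k⟩ =ᵐ[μ] fun ω => vertexTable (p ω) 0 :=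
      hp.sum_eq_one.mono fun ω hω => condProb_empty hω 0 (forwardParents_zero _) k
    rw [mixedMoment_congr hroot, funext (familyTable_empty _ 0 (forwardParents_zero _) k)]
    exact isPolya_vertexTable_of_edgeTable hp hforward (isForestRank_forwardParents _)
      (forwardParents_succ 0) (hedge 0)
  | succ j =>
    exact isPolya_condVector_of_edgeTable hp hforward (isForestRank_forwardParents _)
      (forwardParents_succ j) (hedge j) k

end ChainUrns

end Chain

/-! ### Directed factorizations -/

section DirectedFactorization

variable {V : Type*} [Fintype V] [DecidableEq V] {I : V → Type*} [∀ v, Fintype (I v)]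
  [∀ v, DecidableEq (I v)] {Ω : Type*} [MeasurableSpace Ω] {μ : Measure Ω}
  {p : Ω → ((v : V) → I v) → ℝ} {pa : V → Finset V}

theorem mixedMoment_eq_prod_condVector (hp : IsRandomProbability μ p)
    (h : iIndepFun (condVector p pa) μ)
    (hfac : ∀ᵐ ω ∂μ, ∀ i, p ω i = ∏ v, condProb (p ω) v (pa v) ((pa v).restrict i) (i v))
    (r : ((v : V) → I v) → ℕ) :
    mixedMoment μ p r =
      ∏ v, ∏ k, mixedMoment μ (condVector p pa ⟨v, k⟩) (familyTable r v (pa v) k) := by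
  have monomial_eq : ∀ᵐ ω ∂μ, ∏ i, p ω i ^ r i = ∏ s : Σ v : V, ((a : pa v) → I a),
      ∏ m, condVector p pa s ω m ^ familyTable r s.1 (pa s.1) s.2 m := by
    filter_upwards [hfac] with ω hω
    simp only [hω, ← Finset.prod_pow]
    rw [Finset.prod_comm, Fintype.prod_sigma]
    refine Finset.prod_congr rfl fun v _ => ?_
    rw [← prod_pow_map (fun i => ((pa v).restrict i, i v))
      (fun x => condProb (p ω) v (pa v) x.1 x.2), Fintype.prod_prod_type]
    rfl
  rw [mixedMoment, integral_congr_ae monomial_eq, ← Fintype.prod_sigma'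
    fun v k => mixedMoment μ (condVector p pa ⟨v, k⟩) (familyTable r v (pa v) k)]
  exact h.integral_fun_prod_comp (𝕜 := ℝ)
    (f := fun (s : Σ v : V, ((a : pa v) → I a)) (x : I s.1 → ℝ) =>
      ∏ m, x m ^ familyTable r s.1 (pa s.1) s.2 m)
    (fun s => (hp.measurable_condVector s).aemeasurable)
    fun s => Measurable.aestronglyMeasurable (by fun_prop)

variable [∀ v, Nonempty (I v)] [IsProbabilityMeasure μ] {b : ((v : V) → I v) → ℝ}

theorem predictive_eq_prod_condVector (hp : IsRandomProbability μ p)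
    (h : iIndepFun (condVector p pa) μ) (hpa : ∀ v, v ∉ pa v)
    (hfac : ∀ᵐ ω ∂μ, ∀ i, p ω i = ∏ v, condProb (p ω) v (pa v) ((pa v).restrict i) (i v))
    (r : ((v : V) → I v) → ℕ) (i : (v : V) → I v) :
    predictive (mixedMoment μ p) r i =
      ∏ v, predictive (mixedMoment μ (condVector p pa ⟨v, (pa v).restrict i⟩))
        (familyTable r v (pa v) ((pa v).restrict i)) (i v) := by
  simp only [predictive, mixedMoment_eq_prod_condVector hp h hfac, ← Finset.prod_div_distrib]
  refine Finset.prod_congr rfl fun v _ => ?_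
  rw [Fintype.prod_eq_single ((pa v).restrict i), familyTable_add_single]
  intro k hk
  rw [familyTable_add_single_of_ne r i v (pa v) hk, div_self]
  exact ((isRandomWeights_condVector hp ⟨v, k⟩ (hpa v)).mixedMoment_pos _).ne'

theorem predictive_eq_prod_condProb_add (hp : IsRandomProbability μ p)
    (h : iIndepFun (condVector p pa) μ) (hpa : ∀ v, v ∉ pa v)
    (hfac : ∀ᵐ ω ∂μ, ∀ i, p ω i = ∏ v, condProb (p ω) v (pa v) ((pa v).restrict i) (i v))
    (hb : ∀ i, 0 < b i)
    (hpolya : ∀ v k, IsPolya (predictive (mixedMoment μ (condVector p pa ⟨v, k⟩)))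
      (familyTable b v (pa v) k) 1)
    (r : ((v : V) → I v) → ℕ) (i : (v : V) → I v) :
    predictive (mixedMoment μ p) r i =
      ∏ v, condProb (fun j => b j + r j) v (pa v) ((pa v).restrict i) (i v) := by
  rw [predictive_eq_prod_condVector hp h hpa hfac]
  refine Finset.prod_congr rfl fun v _ => ?_
  set k := (pa v).restrict i
  have marginal_eq : marginal (fun j => b j + r j) (pa v) k =
      ∑ m, familyTable b v (pa v) k m + 1 * ∑ m, ((familyTable r v (pa v) k m : ℕ) : ℝ) := by
    rw [marginal_add_natCast, ← sum_familyTable b v, ← sum_familyTable r v, Nat.cast_sum, one_mul]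
  have marginal_ne_zero : marginal (fun j => b j + r j) (pa v) k ≠ 0 :=
    (marginal_pos (fun j => add_pos_of_pos_of_nonneg (hb j) (Nat.cast_nonneg _)) _ _).ne'
  rw [condProb_eq_div, eq_div_iff marginal_ne_zero, marginal_eq, familyTable_add_natCast,
    hpolya v k, one_mul]

theorem ae_eq_prod_mean_of_isPolya_zero (hp : IsRandomProbability μ p) (hpa : ∀ v, v ∉ pa v)
    (hfac : ∀ᵐ ω ∂μ, ∀ i, p ω i = ∏ v, condProb (p ω) v (pa v) ((pa v).restrict i) (i v))
    (hb : ∀ i, 0 < b i)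
    (hpolya : ∀ v k, IsPolya (predictive (mixedMoment μ (condVector p pa ⟨v, k⟩)))
      (familyTable b v (pa v) k) 0) :
    ∀ᵐ ω ∂μ, p ω = fun i => ∏ v, mean μ (condVector p pa ⟨v, (pa v).restrict i⟩) (i v) := by
  have condVector_eq : ∀ᵐ ω ∂μ, ∀ v k, condVector p pa ⟨v, k⟩ ω =
      mean μ (condVector p pa ⟨v, k⟩) := by
    refine ae_all_iff.2 fun v => ae_all_iff.2 fun k => ?_
    refine (isRandomWeights_condVector hp ⟨v, k⟩ (hpa v)).ae_eq_mean_of_isPolya_zero ?_ (hpolya v k)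
    rw [sum_familyTable]
    exact (marginal_pos hb _ _).ne'
  filter_upwards [hfac, condVector_eq] with ω hω hmean
  ext i
  rw [hω i]
  exact Finset.prod_congr rfl fun v _ => congrFun (hmean v _) (i v)

end DirectedFactorization

/-! ### The normalizing constant -/

section NormalizingConstant

variable {V : Type*} [Fintype V] [DecidableEq V] {I : V → Type*} [∀ v, Fintype (I v)]
  [∀ v, DecidableEq (I v)] [∀ v, Nonempty (I v)] {x : ((v : V) → I v) → ℝ}

theorem prod_Gamma_marginal_add_single (hx : ∀ i, 0 < x i) (i : (v : V) → I v) (A : Finset V) :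
    ∏ k, Real.Gamma (marginal (x + Pi.single i 1) A k) =
      marginal x A (A.restrict i) * ∏ k, Real.Gamma (marginal x A k) := by
  rw [marginal_add_single, ← Finset.mul_prod_erase _ _ (Finset.mem_univ (A.restrict i)),
    ← Finset.mul_prod_erase (a := A.restrict i) _ (fun k => Real.Gamma (marginal x A k))
      (Finset.mem_univ _), ← mul_assoc]
  congr 1
  · rw [Pi.add_apply, Pi.single_eq_same, Real.Gamma_add_one (marginal_pos hx _ _).ne']
  · refine Finset.prod_congr rfl fun k hk => ?_
    rw [Pi.add_apply, Pi.single_eq_of_ne (Finset.ne_of_mem_erase hk), add_zero]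

variable {K : ℕ} (C : Fin K → Finset V)

theorem normConst_marginal_add_single (hx : ∀ i, 0 < x i) (i : (v : V) → I v) :
    normConst C (marginal (x + Pi.single i 1)) = normConst C (marginal x) *
      ((∏ l, marginal x (C l) ((C l).restrict i)) /
        ∏ l, marginal x (separator C l) ((separator C l).restrict i)) := by
  simp only [normConst, prod_Gamma_marginal_add_single hx, Finset.prod_mul_distrib]
  rw [mul_div_mul_comm, mul_comm]

theorem normConst_marginal_pos (hx : ∀ i, 0 < x i) : 0 < normConst C (marginal x) := by
  have prod_Gamma_pos (A : Finset V) : 0 < ∏ k, Real.Gamma (marginal x A k) :=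
    Finset.prod_pos fun k _ => Real.Gamma_pos_of_pos (marginal_pos hx A k)
  exact div_pos (Finset.prod_pos fun l _ => prod_Gamma_pos (C l))
    (Finset.prod_pos fun l _ => prod_Gamma_pos (separator C l))

theorem isHyperParameter_marginal (hx : ∀ i, 0 < x i) : IsHyperParameter C (marginal x) where
  clique_pos _ _ := marginal_pos hx _ _
  separator_pos _ _ := marginal_pos hx _ _
  consistent l m h n := by
    rw [← FunOnFinite.map_apply_apply, marginal_eq_map, marginal_eq_map, map_map]
    rfl

end NormalizingConstant

/-! ### Perfect clique orders -/

section PerfectCliqueOrder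

variable {V : Type*} [DecidableEq V] {K : ℕ}

theorem separator_zero (C : Fin (K + 1) → Finset V) : separator C 0 = ∅ := by
  simp [separator, show Finset.Iio (0 : Fin (K + 1)) = ∅ from Finset.Iio_bot]

theorem IsPerfectCliqueOrder.exists_mem [Finite V] {G : SimpleGraph V} {C : Fin K → Finset V}
    (hC : IsPerfectCliqueOrder G C) (v : V) : ∃ l, v ∈ C l := by
  obtain ⟨D, hvD, hD⟩ := Finite.exists_le_maximal
    (p := fun A : Finset V => G.IsClique (A : Set V)) (a := {v}) (by simp)
  obtain ⟨l, rfl⟩ := (hC.mem_range D).2 hD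
  exact ⟨l, Finset.singleton_subset_iff.1 hvD⟩

theorem card_filter_mem_separator_add_one {C : Fin K → Finset V} {v : V} (hv : ∃ l, v ∈ C l) :
    (Finset.univ.filter fun l => v ∈ separator C l).card + 1 =
      (Finset.univ.filter fun l => v ∈ C l).card := by
  obtain ⟨l₀, hl₀, first⟩ : ∃ l₀, v ∈ C l₀ ∧ ∀ l, v ∈ C l → l₀ ≤ l :=
    (Set.toFinite {l | v ∈ C l}).exists_minimal hv |>.imp fun l₀ h =>
      ⟨h.prop, fun l hl => (le_total l₀ l).elim id (h.le_of_le hl)⟩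
  rw [← Finset.card_erase_add_one (show l₀ ∈ Finset.univ.filter fun l => v ∈ C l by simpa)]
  congr 2
  ext l
  simp only [separator, Finset.mem_filter_univ, Finset.mem_inter, Finset.mem_biUnion,
    Finset.mem_Iio, Finset.mem_erase]
  constructor
  · rintro ⟨hvl, l', hl', hvl'⟩
    exact ⟨((first l' hvl').trans_lt hl').ne', hvl⟩
  · rintro ⟨hne, hvl⟩
    exact ⟨hvl, l₀, (first l hvl).lt_of_ne hne.symm, hl₀⟩

@[to_additive]
theorem prod_separator_mul_prod [Fintype V] {M : Type*} [CommMonoid M] {C : Fin K → Finset V}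
    (hC : ∀ v, ∃ l, v ∈ C l) (g : V → M) :
    (∏ l, ∏ v ∈ separator C l, g v) * ∏ v, g v = ∏ l, ∏ v ∈ C l, g v := by
  have prod_eq (S : Fin K → Finset V) : ∏ l, ∏ v ∈ S l, g v =
      ∏ v, g v ^ (Finset.univ.filter fun l => v ∈ S l).card := by
    rw [Finset.prod_comm' (t' := Finset.univ) (s' := fun v => Finset.univ.filter fun l => v ∈ S l)
      (by simp)]
    simp only [Finset.prod_const]
  simp only [prod_eq, ← Finset.prod_mul_distrib, ← pow_succ,
    card_filter_mem_separator_add_one (hC _)]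

end PerfectCliqueOrder

section ChainCliques

variable {n : ℕ}

/-- The edge `{j, j + 1}` of the chain. -/
def chainEdge (j : Fin n) : Finset (Fin (n + 1)) := {j.castSucc, j.succ}

theorem card_chainEdge (j : Fin n) : (chainEdge j).card = 2 :=
  Finset.card_pair Fin.castSucc_lt_succ.ne

theorem chainEdge_injective : Function.Injective (chainEdge (n := n)) := by
  intro j k hjk
  have castSucc_mem : j.castSucc ∈ chainEdge k := by rw [← hjk]; simp [chainEdge]
  have succ_mem : j.succ ∈ chainEdge k := by rw [← hjk]; simp [chainEdge]
  simp only [chainEdge, Finset.mem_insert, Finset.mem_singleton, Fin.ext_iff, Fin.val_castSucc,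
    Fin.val_succ] at castSucc_mem succ_mem ⊢
  omega

theorem isClique_chainEdge (j : Fin n) :
    (SimpleGraph.pathGraph (n + 1)).IsClique (chainEdge j : Set (Fin (n + 1))) := by
  rw [chainEdge, Finset.coe_pair, SimpleGraph.isClique_pair]
  exact fun _ => SimpleGraph.pathGraph_adj.2 (.inl rfl)

theorem exists_subset_chainEdge {A : Finset (Fin (n + 2))}
    (hA : (SimpleGraph.pathGraph (n + 2)).IsClique (A : Set (Fin (n + 2)))) :
    ∃ j, A ⊆ chainEdge j := by
  rcases A.eq_empty_or_nonempty with rfl | hne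
  · exact ⟨0, Finset.empty_subset _⟩
  set x := A.min' hne
  refine ⟨⟨min x.val n, by omega⟩, fun y hy => ?_⟩
  have min_le : x.val ≤ y.val := A.min'_le y hy
  have eq_or_adj : x = y ∨ (SimpleGraph.pathGraph (n + 2)).Adj x y :=
    or_iff_not_imp_left.2 (hA (A.min'_mem hne) hy)
  rw [SimpleGraph.pathGraph_adj, Fin.ext_iff] at eq_or_adj
  have := y.isLt
  simp only [chainEdge, Finset.mem_insert, Finset.mem_singleton, Fin.ext_iff, Fin.val_castSucc,
    Fin.val_succ]
  omega

theorem maximal_isClique_pathGraph_iff {D : Finset (Fin (n + 2))} :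
    Maximal (fun A : Finset (Fin (n + 2)) =>
      (SimpleGraph.pathGraph (n + 2)).IsClique (A : Set (Fin (n + 2)))) D ↔
      ∃ j, chainEdge j = D := by
  constructor
  · intro hD
    obtain ⟨j, hj⟩ := exists_subset_chainEdge hD.prop
    exact ⟨j, (hD.eq_of_le (isClique_chainEdge j) hj).symm⟩
  · rintro ⟨j, rfl⟩
    refine ⟨isClique_chainEdge j, fun A hA hjA => ?_⟩
    obtain ⟨k, hk⟩ := exists_subset_chainEdge hA
    have : chainEdge j = chainEdge k :=
      Finset.eq_of_subset_of_card_le (hjA.trans hk) (by simp only [card_chainEdge, le_refl])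
    rwa [this]

theorem IsPerfectCliqueOrder.exists_equiv_chainEdge {K : ℕ} {C : Fin K → Finset (Fin (n + 2))}
    (hC : IsPerfectCliqueOrder (SimpleGraph.pathGraph (n + 2)) C) :
    ∃ e : Fin (n + 1) ≃ Fin K, ∀ j, C (e j) = chainEdge j := by
  choose e he using fun j : Fin (n + 1) =>
    (hC.mem_range _).2 (maximal_isClique_pathGraph_iff.2 ⟨j, rfl⟩)
  refine ⟨Equiv.ofBijective e ⟨fun j k hjk => ?_, fun l => ?_⟩, he⟩
  · exact chainEdge_injective ((he j).symm.trans ((congrArg C hjk).trans (he k)))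
  · obtain ⟨j, hj⟩ := maximal_isClique_pathGraph_iff.1 ((hC.mem_range (C l)).1 ⟨l, rfl⟩)
    exact ⟨j, hC.injective ((he j).trans hj)⟩

variable {C : Fin (n + 1) → Finset (Fin (n + 2))}

theorem IsPerfectCliqueOrder.card_eq_two
    (hC : IsPerfectCliqueOrder (SimpleGraph.pathGraph (n + 2)) C) (l : Fin (n + 1)) :
    (C l).card = 2 := by
  obtain ⟨j, hj⟩ := maximal_isClique_pathGraph_iff.1 ((hC.mem_range (C l)).1 ⟨l, rfl⟩)
  rw [← hj, card_chainEdge]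

theorem IsPerfectCliqueOrder.card_separator_succ_le_one
    (hC : IsPerfectCliqueOrder (SimpleGraph.pathGraph (n + 2)) C) (l : Fin n) :
    (separator C l.succ).card ≤ 1 := by
  by_contra! two_le
  obtain ⟨i, hi, hsub⟩ := hC.running l.succ l.succ_pos
  have eq_self : separator C l.succ = C l.succ :=
    Finset.eq_of_subset_of_card_le Finset.inter_subset_left (by rwa [hC.card_eq_two])
  have eq_earlier : separator C l.succ = C i :=
    Finset.eq_of_subset_of_card_le hsub (by rwa [hC.card_eq_two])
  exact hi.ne (hC.injective (eq_earlier.symm.trans eq_self))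

/-- The `n` separators after the first have `2 (n + 1) - (n + 2) = n` elements in total, so none of
them is empty. -/
theorem IsPerfectCliqueOrder.card_separator_succ
    (hC : IsPerfectCliqueOrder (SimpleGraph.pathGraph (n + 2)) C) (l : Fin n) :
    (separator C l.succ).card = 1 := by
  have total := sum_separator_add_sum hC.exists_mem fun _ => 1
  simp only [Finset.sum_const, smul_eq_mul, mul_one, hC.card_eq_two, Finset.card_univ,
    Fintype.card_fin] at total
  rw [Fin.sum_univ_succ, separator_zero, Finset.card_empty] at total
  have sum_eq : ∑ l : Fin n, (separator C l.succ).card = ∑ l : Fin n, 1 := by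
    simp only [Finset.sum_const, Finset.card_univ, Fintype.card_fin, smul_eq_mul,
      mul_one]
    omega
  exact (Finset.sum_eq_sum_iff_of_le fun l _ => hC.card_separator_succ_le_one l).1 sum_eq l
    (Finset.mem_univ l)

variable {I : Fin (n + 2) → Type*} [∀ v, Fintype (I v)] [∀ v, DecidableEq (I v)]
  {x : ((v : Fin (n + 2)) → I v) → ℝ}

theorem IsPerfectCliqueOrder.prod_marginal_clique {K : ℕ} {C : Fin K → Finset (Fin (n + 2))}
    (hC : IsPerfectCliqueOrder (SimpleGraph.pathGraph (n + 2)) C)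
    (i : (v : Fin (n + 2)) → I v) :
    ∏ l, marginal x (C l) ((C l).restrict i) =
      ∏ j : Fin (n + 1), edgeTable x j.castSucc j.succ (i j.castSucc, i j.succ) := by
  obtain ⟨e, he⟩ := hC.exists_equiv_chainEdge
  rw [← e.prod_comp]
  refine Finset.prod_congr rfl fun j _ => ?_
  rw [he, chainEdge, marginal_pair]

theorem IsPerfectCliqueOrder.prod_marginal_separator_eq
    (hC : IsPerfectCliqueOrder (SimpleGraph.pathGraph (n + 2)) C)
    (i : (v : Fin (n + 2)) → I v) :
    ∏ l, marginal x (separator C l) ((separator C l).restrict i) =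
      (∑ i, x i) * ∏ l, ∏ v ∈ separator C l, vertexTable x v (i v) := by
  rw [Fin.prod_univ_succ, Fin.prod_univ_succ, marginal_empty x (separator_zero C),
    separator_zero, Finset.prod_empty, one_mul]
  congr 1
  refine Finset.prod_congr rfl fun l _ => ?_
  obtain ⟨w, hw⟩ := Finset.card_eq_one.1 (hC.card_separator_succ l)
  rw [← singletonCellEquiv_apply hw, marginal_singleton, hw, Finset.prod_singleton]

variable [∀ v, Nonempty (I v)]

theorem IsPerfectCliqueOrder.vertexTable_mul_prod_marginal_separator
    (hC : IsPerfectCliqueOrder (SimpleGraph.pathGraph (n + 2)) C) (hx : ∀ i, 0 < x i)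
    (i : (v : Fin (n + 2)) → I v) :
    vertexTable x 0 (i 0) * ∏ l, marginal x (separator C l) ((separator C l).restrict i) =
      (∑ i, x i) * ∏ j : Fin (n + 1), vertexTable x j.castSucc (i j.castSucc) := by
  obtain ⟨e, he⟩ := hC.exists_equiv_chainEdge
  have targets_ne_zero : ∏ j : Fin (n + 1), vertexTable x j.succ (i j.succ) ≠ 0 :=
    Finset.prod_ne_zero_iff.2 fun j _ => (vertexTable_pos hx _ _).ne'
  have incidences := prod_separator_mul_prod hC.exists_mem fun v => vertexTable x v (i v)
  rw [← e.prod_comp (fun l => ∏ v ∈ C l, vertexTable x v (i v))] at incidences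
  simp only [he, chainEdge, Finset.prod_pair Fin.castSucc_lt_succ.ne, Finset.prod_mul_distrib]
    at incidences
  rw [Fin.prod_univ_succ (fun v => vertexTable x v (i v)), ← mul_assoc] at incidences
  rw [hC.prod_marginal_separator_eq, ← mul_right_cancel₀ targets_ne_zero incidences]
  ring

theorem IsPerfectCliqueOrder.prod_condProb_forwardParents {K : ℕ} {C : Fin K → Finset (Fin (n + 2))}
    (hC : IsPerfectCliqueOrder (SimpleGraph.pathGraph (n + 2)) C) (hx : ∀ i, 0 < x i)
    (i : (v : Fin (n + 2)) → I v) :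
    ∏ v, condProb x v (forwardParents (n + 2) v) ((forwardParents (n + 2) v).restrict i) (i v) =
      (∏ l, marginal x (C l) ((C l).restrict i)) /
        ∏ l, marginal x (separator C l) ((separator C l).restrict i) := by
  obtain ⟨e, -⟩ := hC.exists_equiv_chainEdge
  obtain rfl : n + 1 = K := by simpa using Fintype.card_congr e
  have root : condProb x 0 (forwardParents (n + 2) 0) ((forwardParents (n + 2) 0).restrict i)
      (i 0) = vertexTable x 0 (i 0) / ∑ i, x i := by
    rw [condProb_eq_div, familyTable_empty _ _ (forwardParents_zero _),
      marginal_empty _ (forwardParents_zero _)]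
  have child (j : Fin (n + 1)) : condProb x j.succ (forwardParents (n + 2) j.succ)
      ((forwardParents (n + 2) j.succ).restrict i) (i j.succ) =
        edgeTable x j.castSucc j.succ (i j.castSucc, i j.succ) /
          vertexTable x j.castSucc (i j.castSucc) := by
    rw [← singletonCellEquiv_apply (forwardParents_succ j), condProb_eq_div,
      familyTable_singleton, marginal_singleton]
  have root_ne_zero : vertexTable x 0 (i 0) ≠ 0 := (vertexTable_pos hx 0 (i 0)).ne'
  rw [Fin.prod_univ_succ, root]
  simp only [child, Finset.prod_div_distrib]
  rw [div_mul_div_comm, ← hC.vertexTable_mul_prod_marginal_separator hx,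
    mul_div_mul_left _ _ root_ne_zero, hC.prod_marginal_clique]

theorem Factorizes.eq_prod_condProb_forwardParents
    (hx : Factorizes (SimpleGraph.pathGraph (n + 2)) x) (hpos : ∀ i, 0 < x i)
    (hsum : ∑ i, x i = 1) (i : (v : Fin (n + 2)) → I v) :
    x i = ∏ v, condProb x v (forwardParents (n + 2) v)
      ((forwardParents (n + 2) v).restrict i) (i v) := by
  obtain ⟨K, C, hC, hfac⟩ := hx
  rw [hC.prod_condProb_forwardParents hpos, hfac]
  congr 1
  refine Finset.prod_subset (Finset.filter_subset _ _) fun l _ hl => ?_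
  obtain ⟨K, rfl⟩ := Nat.exists_eq_add_one_of_ne_zero l.pos.ne'
  obtain rfl : l = 0 := by simpa [Fin.pos_iff_ne_zero] using hl
  rw [marginal_empty x (separator_zero C), hsum]

end ChainCliques

/-! ### The hyper Dirichlet law of the chain -/

theorem eq_normConst_div_of_predictive {V : Type*} [Fintype V] [DecidableEq V] {I : V → Type*}
    [∀ v, Fintype (I v)] [∀ v, DecidableEq (I v)] [∀ v, Nonempty (I v)]
    {M : (((v : V) → I v) → ℕ) → ℝ} {b : ((v : V) → I v) → ℝ} {K : ℕ} {C : Fin K → Finset V}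
    (hM_zero : M 0 = 1) (hM : ∀ r, M r ≠ 0) (hb : ∀ i, 0 < b i)
    (hpred : ∀ r i, predictive M r i =
      (∏ l, marginal (fun j => b j + r j) (C l) ((C l).restrict i)) /
        ∏ l, marginal (fun j => b j + r j) (separator C l) ((separator C l).restrict i))
    (r : ((v : V) → I v) → ℕ) :
    M r = normConst C (fun A k => marginal b A k + (marginal r A k : ℕ)) /
      normConst C (marginal b) := by
  have marginal_eq (r : ((v : V) → I v) → ℕ) :
      (fun A k => marginal b A k + (marginal r A k : ℕ)) = marginal fun j => b j + r j := by
    ext A k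
    rw [marginal_add_natCast]
  rw [marginal_eq]
  induction r using table_induction with
  | zero => simp [hM_zero, div_self (normConst_marginal_pos C hb).ne']
  | add_single r i ih =>
    have posterior_pos (j : (v : V) → I v) : 0 < b j + r j :=
      add_pos_of_pos_of_nonneg (hb j) (Nat.cast_nonneg _)
    have posterior_add_single :
        (fun j => b j + ((r + Pi.single i 1 : ((v : V) → I v) → ℕ) j : ℕ)) =
          (fun j => b j + (r j : ℝ)) + Pi.single i 1 := by
      ext j
      simp [Pi.single_apply, add_assoc]
    rw [posterior_add_single, normConst_marginal_add_single C posterior_pos, ← hpred,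
      mul_div_right_comm, ← ih, predictive, mul_div_cancel₀ _ (hM r)]

section ChainMoments

variable {n : ℕ} {I : Fin (n + 2) → Type*} [∀ v, Fintype (I v)] [∀ v, DecidableEq (I v)]
  [∀ v, Nontrivial (I v)] {Ω : Type*} [MeasurableSpace Ω] {μ : Measure Ω} [IsProbabilityMeasure μ]
  {p : Ω → ((v : Fin (n + 2)) → I v) → ℝ}

theorem exists_predictive_eq_prod_condProb_add (hp : IsRandomProbability μ p)
    (hG : ∀ᵐ ω ∂μ, Factorizes (SimpleGraph.pathGraph (n + 2)) (p ω))
    (hconst : ¬ ∃ x, ∀ᵐ ω ∂μ, p ω = x)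
    (hforward : iIndepFun (condVector p (forwardParents (n + 2))) μ)
    (hbackward : iIndepFun (condVector p (backwardParents (n + 2))) μ) :
    ∃ b : ((v : Fin (n + 2)) → I v) → ℝ, (∀ i, 0 < b i) ∧
      ∀ (r : ((v : Fin (n + 2)) → I v) → ℕ) i, predictive (mixedMoment μ p) r i =
        ∏ v, condProb (fun j => b j + r j) v (forwardParents (n + 2) v)
          ((forwardParents (n + 2) v).restrict i) (i v) := by
  have hfac : ∀ᵐ ω ∂μ, ∀ i, p ω i = ∏ v, condProb (p ω) v (forwardParents (n + 2) v)
      ((forwardParents (n + 2) v).restrict i) (i v) := by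
    filter_upwards [hG, hp.pos, hp.sum_eq_one] with ω hω hpos hsum
    exact hω.eq_prod_condProb_forwardParents hpos hsum
  have hpa := (isForestRank_forwardParents (n + 1)).notMem
  obtain ⟨c, hc, hpolya⟩ := exists_isPolya_condVector_forwardParents hp hforward hbackward
  obtain rfl | c_pos := hc.eq_or_lt
  · exact absurd ⟨_, ae_eq_prod_mean_of_isPolya_zero hp hpa hfac hp.isRandomWeights.mean_pos hpolya⟩
      hconst
  have b_pos (i : (v : Fin (n + 2)) → I v) : 0 < c⁻¹ * mean μ p i :=
    mul_pos (inv_pos.2 c_pos) (hp.isRandomWeights.mean_pos i)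
  refine ⟨_, b_pos, predictive_eq_prod_condProb_add hp hforward hpa hfac b_pos fun v k => ?_⟩
  rw [funext (familyTable_const_mul _ _ _ _ k), ← inv_mul_cancel₀ c_pos.ne']
  exact (hpolya v k).const_mul c⁻¹

end ChainMoments

section Nondegenerate

variable {V : Type*} [Fintype V] [DecidableEq V] {I : V → Type*} [∀ v, Fintype (I v)]
  [∀ v, DecidableEq (I v)] [∀ v, Nonempty (I v)] {Ω : Type*} [MeasurableSpace Ω] {μ : Measure Ω}
  {p : Ω → ((v : V) → I v) → ℝ} {pa : V → Finset V}

namespace ParameterIndependence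

theorem nontrivial (h : ParameterIndependence μ p pa) (hp : IsRandomProbability μ p) (v : V) :
    Nontrivial (I v) := by
  rw [← not_subsingleton_iff_nontrivial]
  intro hsub
  let k : (a : pa v) → I a := fun _ => Classical.arbitrary _
  refine h.nondegenerate v k ⟨1, ?_⟩
  filter_upwards [hp.pos] with ω hω
  ext m
  have family_eq : familyTable (p ω) v (pa v) k m = marginal (p ω) (pa v) k := by
    rw [← sum_familyTable _ v, Fintype.sum_subsingleton _ m]
  rw [condProb_eq_div, family_eq, div_self (marginal_pos hω _ _).ne', Pi.one_apply]

theorem not_ae_eq_const [Nonempty V] (h : ParameterIndependence μ p pa) :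
    ¬ ∃ x, ∀ᵐ ω ∂μ, p ω = x := by
  rintro ⟨x, hx⟩
  obtain ⟨v⟩ := ‹Nonempty V›
  exact h.nondegenerate v (fun _ => Classical.arbitrary _)
    ⟨_, hx.mono fun ω hω => by rw [hω]⟩

end ParameterIndependence

end Nondegenerate

end HyperDirichlet

open HyperDirichlet in
theorem mainTheorem5_general {d : ℕ} (hd : 2 ≤ d) {I : Fin d → Type*} [∀ v, Fintype (I v)]
    [∀ v, DecidableEq (I v)] [∀ v, Nontrivial (I v)] {Ω : Type*} [MeasurableSpace Ω]
    (μ : Measure Ω) [IsProbabilityMeasure μ] (p : Ω → ((v : Fin d) → I v) → ℝ)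
    (hp : IsRandomProbability μ p)
    (hG : ∀ᵐ ω ∂μ, Factorizes (SimpleGraph.pathGraph d) (p ω))
    (hconst : ¬ ∃ x, ∀ᵐ ω ∂μ, p ω = x)
    (hforward : iIndepFun (condVector p (forwardParents d)) μ)
    (hbackward : iIndepFun (condVector p (backwardParents d)) μ) :
    HasHyperDirichletLaw (SimpleGraph.pathGraph d) μ p := by
  obtain ⟨n, rfl⟩ := Nat.exists_eq_add_of_le' hd
  obtain ⟨_, K, C, hC, -⟩ := hG.exists
  obtain ⟨b, hb, hpred⟩ := exists_predictive_eq_prod_condProb_add hp hG hconst hforward hbackward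
  refine ⟨K, C, hC, marginal b, isHyperParameter_marginal C hb, ?_⟩
  refine eq_normConst_div_of_predictive (M := mixedMoment μ p) mixedMoment_zero
    (fun r => (hp.isRandomWeights.mixedMoment_pos r).ne') hb fun r i => ?_
  have posterior_pos (j : (v : Fin (n + 2)) → I v) : 0 < b j + r j :=
    add_pos_of_pos_of_nonneg (hb j) (Nat.cast_nonneg _)
  rw [hpred, hC.prod_condProb_forwardParents posterior_pos]

theorem mainTheorem5 {d : ℕ} (hd : 2 ≤ d) {I : Fin d → Type*} [∀ v, Fintype (I v)]
    [∀ v, DecidableEq (I v)] {Ω : Type*} [MeasurableSpace Ω] (μ : Measure Ω)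
    [IsProbabilityMeasure μ] (p : Ω → ((v : Fin d) → I v) → ℝ)
    (hp : HyperDirichlet.IsRandomProbability μ p)
    (hG : ∀ᵐ ω ∂μ, HyperDirichlet.Factorizes (SimpleGraph.pathGraph d) (p ω))
    (hforward : HyperDirichlet.ParameterIndependence μ p (HyperDirichlet.forwardParents d))
    (hbackward : HyperDirichlet.ParameterIndependence μ p (HyperDirichlet.backwardParents d)) :
    HyperDirichlet.HasHyperDirichletLaw (SimpleGraph.pathGraph d) μ p := by
  have : Nonempty (Fin d) := ⟨⟨0, by omega⟩⟩
  have (v : Fin d) : Nonempty (I v) := hp.nonempty_cell.map (· v)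
  have (v : Fin d) : Nontrivial (I v) := hforward.nontrivial hp v
  exact mainTheorem5_general hd μ p hp hG hforward.not_ae_eq_const hforward.indep hbackward.indep

end
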